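/- **Conventions.** Manifolds are smooth, finite-dimensional, Hausdorff and without boundary. A *Lie groupoid* $(\mathcal G, M)$ is a groupoid whose arrows form a manifold $\mathcal G$ and whose objects form a manifold $M$, identified with the units in $\mathcal G$, such that the source and target maps $\alpha,\beta:\mathcal G\to M$ are submersions and the multiplication, the inversion and the inclusion $M\to\mathcal G$ of the units are smooth; the product $gh$ is defined when $\beta(g)=\alpha(h)$, and then $\alpha(gh)=\alpha(g)$, $\beta(gh)=\beta(h)$. It is *$\alpha$-connected* if every fibre $\alpha^{-1}(x)$, $x\in M$, is connected. A *(global) bisection* is a smooth map $s:M\to\mathcal G$ with $\alpha\circ s=\mathrm{id}_M$ such that $\beta\circ s$ is a diffeomorphism of $M$. The product of two bisections is $(sw)(x)=s(x)\,w(\beta(s(x)))$. A section $X$ of the Lie algebroid $\mathrm{Lie}\,\mathcal G$ is a smooth family of vectors $X_x\in T_x\mathcal G$, $x\in M$, with $\alpha_*(X_x)=0$. Its left invariant vector field is $\overleftarrow{X}_g=(l_g)_*X_{\beta(g)}$, where $l_g:\alpha^{-1}(\beta(g))\to\alpha^{-1}(\alpha(g))$, $h\mapsto gh$. If $X$ has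 compact support, then $\overleftarrow{X}$ is complete, and $\exp X:M\to\mathcal G$ is the bisection that maps $x$ to the time-$1$ value of the integral curve of $\overleftarrow{X}$ starting at the unit $x$. A bisection is *finitely generated* if it is a product $\exp X_1\exp X_2\cdots\exp X_k$ with compactly supported sections $X_1,\dots,X_k$ of $\mathrm{Lie}\,\mathcal G$. **Theorem.** Let $(\mathcal G,M)$ be an $\alpha$-connected Lie groupoid. Then for every $g\in\mathcal G$ there is a finitely generated bisection $s$ of $\mathcal G$ through $g$, i.e. with $s(\alpha(g))=g$. -/

import Mathlib

open scoped Manifold ContDiff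

/-- A Lie groupoid with space of arrows `𝒢` and base `M`, both smooth manifolds. The base is viewed
inside `𝒢` through `unit`. The product `mul g h` (first `g`, then `h`) is meaningful only for
composable pairs, i.e. when `tgt g = src h`; its values elsewhere are unconstrained and are never
used. The space of composable pairs is an embedded submanifold of `𝒢 × 𝒢`, and smoothness of the
product on it is `ContMDiffOn`. As a smooth section of `src`, the map `unit` is automatically an
embedding. -/
structure LieGroupoid
    {EG : Type*} [NormedAddCommGroup EG] [NormedSpace ℝ EG]
    {HG : Type*} [TopologicalSpace HG] (IG : ModelWithCorners ℝ EG HG)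
    {EM : Type*} [NormedAddCommGroup EM] [NormedSpace ℝ EM]
    {HM : Type*} [TopologicalSpace HM] (IM : ModelWithCorners ℝ EM HM)
    (𝒢 : Type*) [TopologicalSpace 𝒢] [ChartedSpace HG 𝒢] [IsManifold IG ∞ 𝒢]
    (M : Type*) [TopologicalSpace M] [ChartedSpace HM M] [IsManifold IM ∞ M] where
  /-- the source map `α` -/
  src : 𝒢 → M
  /-- the target map `β` -/
  tgt : 𝒢 → M
  /-- the inclusion of the base as the units -/
  unit : M → 𝒢
  /-- the partial multiplication -/
  mul : 𝒢 → 𝒢 → 𝒢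
  /-- the inversion -/
  inv : 𝒢 → 𝒢
  src_mul : ∀ g h, tgt g = src h → src (mul g h) = src g
  tgt_mul : ∀ g h, tgt g = src h → tgt (mul g h) = tgt h
  mul_assoc : ∀ f g h, tgt f = src g → tgt g = src h → mul f (mul g h) = mul (mul f g) h
  src_unit : ∀ x, src (unit x) = x
  tgt_unit : ∀ x, tgt (unit x) = x
  mul_unit : ∀ g, mul g (unit (tgt g)) = g
  unit_mul : ∀ g, mul (unit (src g)) g = g
  src_inv : ∀ g, src (inv g) = tgt g
  tgt_inv : ∀ g, tgt (inv g) = src g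
  inv_mul : ∀ g, mul (inv g) g = unit (tgt g)
  mul_inv : ∀ g, mul g (inv g) = unit (src g)
  isSubmersion_src : Manifold.IsSubmersion IG IM ∞ src
  isSubmersion_tgt : Manifold.IsSubmersion IG IM ∞ tgt
  contMDiff_unit : ContMDiff IM IG ∞ unit
  contMDiff_inv : ContMDiff IG IG ∞ inv
  contMDiffOn_mul : ContMDiffOn (IG.prod IG) IG ∞ (fun p : 𝒢 × 𝒢 => mul p.1 p.2)
    {p : 𝒢 × 𝒢 | tgt p.1 = src p.2}

namespace LieGroupoid

section

variable {EG : Type*} [NormedAddCommGroup EG] [NormedSpace ℝ EG]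
  {HG : Type*} [TopologicalSpace HG] {IG : ModelWithCorners ℝ EG HG}
  {EM : Type*} [NormedAddCommGroup EM] [NormedSpace ℝ EM]
  {HM : Type*} [TopologicalSpace HM] {IM : ModelWithCorners ℝ EM HM}
  {𝒢 : Type*} [TopologicalSpace 𝒢] [ChartedSpace HG 𝒢] [IsManifold IG ∞ 𝒢]
  {M : Type*} [TopologicalSpace M] [ChartedSpace HM M] [IsManifold IM ∞ M]

/-- The Lie groupoid is `α`-connected: all fibres of the source map are connected. -/
def SourceConnected (G : LieGroupoid IG IM 𝒢 M) : Prop :=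
  ∀ x : M, IsConnected (G.src ⁻¹' {x})

/-- A global bisection: a smooth section `s` of the source map such that `β ∘ s` is a
diffeomorphism of the base. -/
structure Bisection (G : LieGroupoid IG IM 𝒢 M) where
  /-- the underlying map -/
  toFun : M → 𝒢
  contMDiff' : ContMDiff IM IG ∞ toFun
  src_apply' : ∀ x, G.src (toFun x) = x
  exists_diffeo' : ∃ φ : M ≃ₘ^∞⟮IM, IM⟯ M, ∀ x, φ x = G.tgt (toFun x)

namespace Bisection

variable {G : LieGroupoid IG IM 𝒢 M}

instance : CoeFun (Bisection G) (fun _ => M → 𝒢) := ⟨Bisection.toFun⟩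

theorem ext' {s w : Bisection G} (h : ∀ x, s x = w x) : s = w := by
  cases s; cases w
  simp only [mk.injEq]
  exact funext h

/-- The identity bisection is the base itself. -/
instance : One (Bisection G) where
  one :=
    { toFun := G.unit
      contMDiff' := G.contMDiff_unit
      src_apply' := G.src_unit
      exists_diffeo' := ⟨Diffeomorph.refl IM M ∞, fun x => (G.tgt_unit x).symm⟩ }

/-- The product of bisections, `(s w)(x) = s(x) w(β(s(x)))`. -/
instance : Mul (Bisection G) where
  mul s w :=
    { toFun := fun x => G.mul (s x) (w (G.tgt (s x)))
      contMDiff' := by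
        have h1 : ContMDiff IM IM ∞ fun x => G.tgt (s x) :=
          G.isSubmersion_tgt.contMDiff.comp s.contMDiff'
        have h2 : ContMDiff IM (IG.prod IG) ∞ fun x => (s x, w (G.tgt (s x))) :=
          s.contMDiff'.prodMk (w.contMDiff'.comp h1)
        exact G.contMDiffOn_mul.comp_contMDiff h2 fun x => (w.src_apply' _).symm
      src_apply' := fun x => by
        rw [G.src_mul _ _ (w.src_apply' _).symm, s.src_apply']
      exists_diffeo' := by
        obtain ⟨φ, hφ⟩ := s.exists_diffeo'
        obtain ⟨ψ, hψ⟩ := w.exists_diffeo'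
        refine ⟨φ.trans ψ, fun x => ?_⟩
        rw [G.tgt_mul _ _ (w.src_apply' _).symm, ← hφ, ← hψ]
        rfl }

theorem one_apply (x : M) : (1 : Bisection G) x = G.unit x := rfl

theorem mul_apply (s w : Bisection G) (x : M) :
    (s * w) x = G.mul (s x) (w (G.tgt (s x))) := rfl

instance : Monoid (Bisection G) where
  mul_assoc a b c := ext' fun x => by
    simp only [mul_apply]
    rw [G.tgt_mul _ _ (b.src_apply' _).symm,
      ← G.mul_assoc _ _ _ (b.src_apply' _).symm (c.src_apply' _).symm]
  one_mul a := ext' fun x => by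
    simp only [mul_apply, one_apply, G.tgt_unit]
    have h := G.unit_mul (a x)
    rwa [a.src_apply'] at h
  mul_one a := ext' fun x => by
    simp only [mul_apply, one_apply, G.mul_unit]

end Bisection

/-- A smooth section of the tangent Lie algebroid
`Lie 𝒢 = {v ∈ T_x 𝒢 | x ∈ M, α_*(v) = 0}`. -/
structure AlgebroidSection (G : LieGroupoid IG IM 𝒢 M) where
  /-- the underlying family of tangent vectors at the units -/
  toFun : ∀ x : M, TangentSpace IG (G.unit x)
  mfderiv_src : ∀ x : M, mfderiv IG IM G.src (G.unit x) (toFun x) = 0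
  contMDiff' : ContMDiff IM IG.tangent ∞
    (fun x => (⟨G.unit x, toFun x⟩ : TangentBundle IG 𝒢))

namespace AlgebroidSection

variable {G : LieGroupoid IG IM 𝒢 M}

/-- The section vanishes outside a compact set: its support (the closure of the set where it does
not vanish) is compact. -/
def HasCompactSupport (X : AlgebroidSection G) : Prop :=
  IsCompact (closure {x : M | X.toFun x ≠ 0})

/-- The left invariant vector field of `X`: its value at `g` is `(l_g)_* X_{β(g)}`, where
`l_g : α⁻¹(β(g)) → α⁻¹(α(g))`, `h ↦ g h`. The derivative of `l_g` is taken within the fibre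
`α⁻¹(β(g))`, and is applied to a vector that is tangent to this fibre, where it is uniquely
determined. It is a tangent vector at `g 1_{β(g)} = g`. -/
noncomputable def leftInvariantField (X : AlgebroidSection G) (g : 𝒢) : TangentSpace IG g :=
  mfderivWithin IG IG (G.mul g) (G.src ⁻¹' {G.tgt g}) (G.unit (G.tgt g)) (X.toFun (G.tgt g))

/-- The bisection `s` is the exponential `exp X`: for all `x` in the base, the integral curve of the
left invariant vector field of `X` that starts at the unit of `x` is defined for all times, and its
value at time `1` is `s x`. -/
def IsExp (X : AlgebroidSection G) (s : Bisection G) : Prop :=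
  ∀ x : M, ∃ γ : ℝ → 𝒢,
    IsMIntegralCurve (I := IG) γ X.leftInvariantField ∧ γ 0 = G.unit x ∧ γ 1 = s x

end AlgebroidSection

/-- A bisection is finitely generated if it is a product `exp X₁ exp X₂ ⋯ exp Xₖ` of exponentials of
compactly supported sections of the Lie algebroid. -/
def Bisection.FinitelyGenerated {G : LieGroupoid IG IM 𝒢 M} (s : Bisection G) : Prop :=
  ∃ (k : ℕ) (X : Fin k → AlgebroidSection G) (e : Fin k → Bisection G),
    (∀ i, (X i).HasCompactSupport) ∧ (∀ i, (X i).IsExp (e i)) ∧ s = (List.ofFn e).prod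

end

end LieGroupoid

/-!
The bisections in question are composed of exponentials that stay close to the units. Near a unit
`x₀` the source map is a projection in suitable charts, which gives a smooth family of maps
`D(x, ·) : F → α⁻¹(x)` with `D(x, 0) = x` (`LieGroupoid.exists_fibreFamily`); after cutting off, it
is defined for all `x ∈ M` and constant outside a compact set. The derivatives `X_a` of `D` at `v = 0`
in the directions `a ∈ F` are compactly supported sections of the Lie algebroid, and their left
invariant fields are the derivatives of the smooth map `(g, v) ↦ g D(β(g), v)`; in particular they
are smooth and linear in `a`.

For small `a` the exponential of `X_a` is found by solving an ordinary differential equation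
`z' = W(z) a` in charts. Smooth dependence of the solutions on the initial value and on `a`
(`exists_contDiffAt_flow`) follows from the inverse function theorem in a space of continuous curves,
where the substitution `γ ↦ W ∘ γ` is smooth (`ContinuousMap.contDiff_postcomp`); at `a = 0` the
linearization is trivially invertible, and this already gives solutions up to time `1`. By
compactness of the support this works simultaneously over all of `M`, and left translation turns
it into completeness of the left invariant field (`IsExpParam.exists_integralCurve`). Uniqueness of
integral curves shows that `exp X_a` and `exp X_{-a}` are mutually inverse bisections
(`LieGroupoid.FibreFamily.exists_exp_bisection`).

The map `a ↦ exp X_a (x₀)` has the same derivative at `a = 0` as `v ↦ D(x₀, v)`, hence covers a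
neighbourhood of the unit in the source fibre (`LieGroupoid.eventually_exists_exp_apply_eq`).
Consequently the set of arrows on finitely generated bisections is open and closed in each source
fibre, and since it contains the unit, connectedness of the fibre gives the theorem.
-/

section

open scoped Topology
open Set

universe u

/-! ### Composition operators and an ordinary differential equation with parameters -/

section Nemytskii

variable {K : Type*} [TopologicalSpace K]

/-- A continuous bilinear map applied pointwise to continuous functions on a compact space, as a
continuous bilinear map between the spaces of continuous functions. -/
noncomputable def ContinuousMap.pointwiseBilin [CompactSpace K] {E₁ E₂ E₃ : Type*}
    [NormedAddCommGroup E₁] [NormedSpace ℝ E₁] [NormedAddCommGroup E₂] [NormedSpace ℝ E₂]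
    [NormedAddCommGroup E₃] [NormedSpace ℝ E₃] (B : E₁ →L[ℝ] E₂ →L[ℝ] E₃) :
    C(K, E₁) →L[ℝ] C(K, E₂) →L[ℝ] C(K, E₃) :=
  LinearMap.mkContinuous₂
    (LinearMap.mk₂ ℝ (fun (f : C(K, E₁)) (g : C(K, E₂)) =>
      (⟨fun k => B (f k) (g k), by fun_prop⟩ : C(K, E₃)))
      (fun _ _ _ => by ext; simp) (fun _ _ _ => by ext; simp)
      (fun _ _ _ => by ext; simp) (fun _ _ _ => by ext; simp))
    ‖B‖ (fun f g => by
      refine (ContinuousMap.norm_le _ (by positivity)).2 fun k => ?_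
      refine (B.le_opNorm₂ _ _).trans ?_
      gcongr
      · exact f.norm_coe_le_norm k
      · exact g.norm_coe_le_norm k)

@[simp]
theorem ContinuousMap.pointwiseBilin_apply [CompactSpace K] {E₁ E₂ E₃ : Type*}
    [NormedAddCommGroup E₁] [NormedSpace ℝ E₁] [NormedAddCommGroup E₂] [NormedSpace ℝ E₂]
    [NormedAddCommGroup E₃] [NormedSpace ℝ E₃] (B : E₁ →L[ℝ] E₂ →L[ℝ] E₃)
    (f : C(K, E₁)) (g : C(K, E₂)) (k : K) :
    ContinuousMap.pointwiseBilin B f g k = B (f k) (g k) := rfl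

/-- The composition operator `γ ↦ f ∘ γ` on continuous functions on a compact space. -/
def ContinuousMap.postcomp {E G : Type*} [TopologicalSpace E] [TopologicalSpace G] (f : E → G)
    (hf : Continuous f) (γ : C(K, E)) : C(K, G) := ⟨fun k => f (γ k), hf.comp γ.continuous⟩

@[simp]
theorem ContinuousMap.postcomp_apply {E G : Type*} [TopologicalSpace E] [TopologicalSpace G]
    (f : E → G) (hf : Continuous f) (γ : C(K, E)) (k : K) : postcomp f hf γ k = f (γ k) := rfl

theorem ContinuousMap.continuous_postcomp' {E G : Type*} [TopologicalSpace E] [TopologicalSpace G]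
    (f : E → G) (hf : Continuous f) : Continuous (postcomp (K := K) f hf) :=
  ContinuousMap.continuous_postcomp ⟨f, hf⟩

/-- Composition with a `C^1` map is differentiable on continuous functions. -/
theorem ContinuousMap.hasFDerivAt_postcomp [CompactSpace K] {E G : Type*}
    [NormedAddCommGroup E] [NormedSpace ℝ E] [NormedAddCommGroup G] [NormedSpace ℝ G] {f : E → G} {f' : E → E →L[ℝ] G}
    (hff' : ∀ x, HasFDerivAt f (f' x) x) (hf : Continuous f) (hf' : Continuous f')
    (γ : C(K, E)) :
    HasFDerivAt (postcomp (K := K) f hf)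
      (pointwiseBilin (ContinuousLinearMap.id ℝ (E →L[ℝ] G)) (postcomp f' hf' γ)) γ := by
  rw [hasFDerivAt_iff_isLittleO, Asymptotics.isLittleO_iff]
  intro ε hε
  have hcont : ContinuousAt (postcomp (K := K) f' hf') γ :=
    (continuous_postcomp' f' hf').continuousAt
  obtain ⟨δ, hδ, hc⟩ := (Metric.continuousAt_iff (α := C(K, E)) (β := C(K, E →L[ℝ] G))).1
    hcont ε hε
  filter_upwards [Metric.ball_mem_nhds γ hδ] with γ₁ hγ₁
  refine (ContinuousMap.norm_le _ (by positivity)).2 fun k => ?_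
  have key : ‖f (γ₁ k) - f (γ k) - f' (γ k) (γ₁ k - γ k)‖ ≤ ε * ‖γ₁ k - γ k‖ := by
    refine (convex_segment (γ k) (γ₁ k)).norm_image_sub_le_of_norm_hasFDerivWithin_le'
      (f' := f') (fun x _ => (hff' x).hasFDerivWithinAt) ?_
      (left_mem_segment ℝ _ _) (right_mem_segment ℝ _ _)
    intro x hx
    rw [segment_eq_image'] at hx
    obtain ⟨θ, hθ, rfl⟩ := hx
    have h1 : dist (γ + θ • (γ₁ - γ)) γ < δ := by
      rw [dist_eq_norm, add_sub_cancel_left, norm_smul]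
      refine lt_of_le_of_lt ?_ (mem_ball_iff_norm.1 hγ₁)
      refine mul_le_of_le_one_left (norm_nonneg _) ?_
      rw [Real.norm_eq_abs, abs_of_nonneg hθ.1]
      exact hθ.2
    have h2 := (dist_apply_le_dist k).trans (hc h1).le
    rw [dist_eq_norm] at h2
    simpa using h2
  refine key.trans ?_
  gcongr
  exact (γ₁ - γ).norm_coe_le_norm k

/-- Composition with a smooth map is smooth on continuous functions: its derivative is again a
composition operator, for `fderiv ℝ f`, followed by a continuous linear map. The two spaces are in
one universe so that the induction may pass from `G` to `E →L[ℝ] G`. -/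
theorem ContinuousMap.contDiff_postcomp [CompactSpace K] {E : Type u}
    [NormedAddCommGroup E] [NormedSpace ℝ E]
    {G : Type u} [NormedAddCommGroup G] [NormedSpace ℝ G] {f : E → G}
    (hf : ContDiff ℝ ∞ f) : ContDiff ℝ ∞ (postcomp (K := K) f hf.continuous) := by
  rw [contDiff_infty]
  intro n
  induction n generalizing G with
  | zero => exact contDiff_zero.2 (continuous_postcomp' f hf.continuous)
  | succ n ih =>
    have hf' : ContDiff ℝ ∞ (fderiv ℝ f) := hf.fderiv_right (by norm_cast)
    refine contDiff_succ_iff_hasFDerivAt.2 ⟨_, ?_, fun γ =>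
      hasFDerivAt_postcomp (f' := fderiv ℝ f)
        (fun x => (hf.differentiable (by simp) x).hasFDerivAt) hf.continuous hf'.continuous γ⟩
    exact (pointwiseBilin (ContinuousLinearMap.id ℝ (E →L[ℝ] G))).contDiff.comp (ih hf')

end Nemytskii

section Flow

variable {E F : Type u} [NormedAddCommGroup E] [NormedSpace ℝ E]
  [NormedAddCommGroup F] [NormedSpace ℝ F]

/-- The primitive vanishing at `0` of a continuous function on `[-2, 2]`. The function is extended
to `ℝ` by constants, so that the primitive is defined on `ℝ`. -/
noncomputable def iccPrimitive (γ : C(Icc (-2 : ℝ) 2, E)) (t : ℝ) : E :=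
  ∫ s in (0 : ℝ)..t, γ (projIcc (-2) 2 (by norm_num) s)

omit [NormedSpace ℝ E] in
theorem continuous_comp_projIcc (γ : C(Icc (-2 : ℝ) 2, E)) :
    Continuous fun s => γ (projIcc (-2) 2 (by norm_num) s) :=
  γ.continuous.comp continuous_projIcc

theorem hasDerivAt_iccPrimitive [CompleteSpace E] (γ : C(Icc (-2 : ℝ) 2, E)) (t : ℝ) :
    HasDerivAt (iccPrimitive γ) (γ (projIcc (-2) 2 (by norm_num) t)) t :=
  intervalIntegral.integral_hasDerivAt_right ((continuous_comp_projIcc γ).intervalIntegrable _ _)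
    (continuous_comp_projIcc γ).stronglyMeasurable.stronglyMeasurableAtFilter
    (continuous_comp_projIcc γ).continuousAt

theorem norm_iccPrimitive_le (γ : C(Icc (-2 : ℝ) 2, E)) (t : Icc (-2 : ℝ) 2) :
    ‖iccPrimitive γ t‖ ≤ 2 * ‖γ‖ := by
  refine (intervalIntegral.norm_integral_le_of_norm_le_const (C := ‖γ‖)
    fun s _ => γ.norm_coe_le_norm _).trans ?_
  rw [mul_comm]
  gcongr
  rw [sub_zero]
  exact abs_le.2 t.2

/-- Integration from `0` as a continuous linear operator on `C([-2, 2], E)`. -/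
noncomputable def iccIntegral [CompleteSpace E] :
    C(Icc (-2 : ℝ) 2, E) →L[ℝ] C(Icc (-2 : ℝ) 2, E) :=
  LinearMap.mkContinuous
    { toFun := fun γ => ⟨fun t => iccPrimitive γ t, by
        have : Continuous (iccPrimitive γ) :=
          continuous_iff_continuousAt.2 fun t => (hasDerivAt_iccPrimitive γ t).continuousAt
        exact this.comp continuous_subtype_val⟩
      map_add' := fun γ η => by
        ext t
        exact intervalIntegral.integral_add ((continuous_comp_projIcc γ).intervalIntegrable _ _)
          ((continuous_comp_projIcc η).intervalIntegrable _ _)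
      map_smul' := fun c γ => by
        ext t
        exact intervalIntegral.integral_smul c _ }
    2 (fun γ => (ContinuousMap.norm_le _ (by positivity)).2 (norm_iccPrimitive_le γ))

theorem iccIntegral_apply [CompleteSpace E] (γ : C(Icc (-2 : ℝ) 2, E)) (t : Icc (-2 : ℝ) 2) :
    iccIntegral γ t = iccPrimitive γ t := rfl

theorem iccPrimitive_const [CompleteSpace E] (c : E) (t : ℝ) :
    iccPrimitive (ContinuousMap.const (Icc (-2 : ℝ) 2) c) t = t • c := by
  simp [iccPrimitive]

/-- The inclusion of the constant functions, as a continuous linear map. -/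
noncomputable def ContinuousMap.constCLM (K V : Type*) [TopologicalSpace K] [CompactSpace K]
    [NormedAddCommGroup V] [NormedSpace ℝ V] : V →L[ℝ] C(K, V) :=
  LinearMap.mkContinuous
    { toFun := fun v => ContinuousMap.const K v
      map_add' := fun _ _ => rfl
      map_smul' := fun _ _ => rfl }
    1 (fun v => (ContinuousMap.norm_le _ (by positivity)).2 fun _ => (one_mul ‖v‖).ge)

@[simp]
theorem ContinuousMap.constCLM_apply {K V : Type*} [TopologicalSpace K] [CompactSpace K]
    [NormedAddCommGroup V] [NormedSpace ℝ V] (v : V) (k : K) :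
    ContinuousMap.constCLM K V v k = v := rfl

/-- The integral equation of `z' = W(z) a` on `[-2, 2]` with initial value `z` at time `0` is
`γ = picardOperator W (z, a) γ`. -/
noncomputable def picardOperator [CompleteSpace E] (W : E → F →L[ℝ] E) (hW : Continuous W)
    (p : (E × F) × C(Icc (-2 : ℝ) 2, E)) : C(Icc (-2 : ℝ) 2, E) :=
  ContinuousMap.constCLM _ E p.1.1 +
    iccIntegral (ContinuousMap.pointwiseBilin (ContinuousLinearMap.id ℝ (F →L[ℝ] E))
      (ContinuousMap.postcomp W hW p.2) (ContinuousMap.constCLM _ F p.1.2))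

theorem contDiff_picardOperator [CompleteSpace E] {W : E → F →L[ℝ] E} (hW : ContDiff ℝ ∞ W) :
    ContDiff ℝ ∞ (picardOperator W hW.continuous) := by
  have h1 : ContDiff ℝ ∞ fun p : (E × F) × C(Icc (-2 : ℝ) 2, E) =>
      ContinuousMap.constCLM (Icc (-2 : ℝ) 2) E p.1.1 :=
    (ContinuousLinearMap.contDiff (ContinuousMap.constCLM (Icc (-2 : ℝ) 2) E)).comp
      (contDiff_fst.comp contDiff_fst)
  have h2 : ContDiff ℝ ∞ fun p : (E × F) × C(Icc (-2 : ℝ) 2, E) =>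
      ContinuousMap.constCLM (Icc (-2 : ℝ) 2) F p.1.2 :=
    (ContinuousLinearMap.contDiff (ContinuousMap.constCLM (Icc (-2 : ℝ) 2) F)).comp
      (contDiff_snd.comp contDiff_fst)
  have hT : ContDiff ℝ ∞ (ContinuousMap.pointwiseBilin (K := Icc (-2 : ℝ) 2)
      (ContinuousLinearMap.id ℝ (F →L[ℝ] E))) := ContinuousLinearMap.contDiff _
  have h3 : ContDiff ℝ ∞ fun p : (E × F) × C(Icc (-2 : ℝ) 2, E) =>
      ContinuousMap.pointwiseBilin (ContinuousLinearMap.id ℝ (F →L[ℝ] E))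
        (ContinuousMap.postcomp W hW.continuous p.2) :=
    hT.comp ((ContinuousMap.contDiff_postcomp hW).comp contDiff_snd)
  exact h1.add ((ContinuousLinearMap.contDiff (iccIntegral (E := E))).comp (h3.clm_apply h2))

/-- The derivative of `picardOperator W` at `(z₀, 0)` and the constant curve, with respect to the
initial value and the parameter. The derivative with respect to the curve is zero. -/
noncomputable def picardDeriv [CompleteSpace E] (A : F →L[ℝ] E) :
    E × F →L[ℝ] C(Icc (-2 : ℝ) 2, E) :=
  (ContinuousMap.constCLM _ E).comp (ContinuousLinearMap.fst ℝ E F) +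
    (iccIntegral.comp ((ContinuousMap.constCLM _ E).comp A)).comp (ContinuousLinearMap.snd ℝ E F)

theorem hasFDerivAt_picardOperator [CompleteSpace E] {W : E → F →L[ℝ] E} (hW : ContDiff ℝ ∞ W)
    (z₀ : E) :
    HasFDerivAt (picardOperator W hW.continuous)
      ((picardDeriv (W z₀)).comp (ContinuousLinearMap.fst ℝ (E × F) C(Icc (-2 : ℝ) 2, E)))
      ((z₀, 0), ContinuousMap.constCLM _ E z₀) := by
  set p₀ : (E × F) × C(Icc (-2 : ℝ) 2, E) := ((z₀, 0), ContinuousMap.constCLM _ E z₀)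
  have h1 : HasFDerivAt (fun p : (E × F) × C(Icc (-2 : ℝ) 2, E) =>
      ContinuousMap.postcomp W hW.continuous p.2) _ p₀ :=
    (((ContinuousMap.contDiff_postcomp hW).comp contDiff_snd).differentiable
      (by simp) p₀).hasFDerivAt
  have h2 : HasFDerivAt (fun p : (E × F) × C(Icc (-2 : ℝ) 2, E) =>
      ContinuousMap.constCLM (Icc (-2 : ℝ) 2) F p.1.2) _ p₀ :=
    (ContinuousLinearMap.hasFDerivAt (ContinuousMap.constCLM (Icc (-2 : ℝ) 2) F)).comp p₀
      (hasFDerivAt_snd.comp p₀ hasFDerivAt_fst)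
  have h3 : HasFDerivAt (fun p : (E × F) × C(Icc (-2 : ℝ) 2, E) =>
      ContinuousMap.constCLM (Icc (-2 : ℝ) 2) E p.1.1) _ p₀ :=
    (ContinuousLinearMap.hasFDerivAt (ContinuousMap.constCLM (Icc (-2 : ℝ) 2) E)).comp p₀
      (hasFDerivAt_fst.comp p₀ hasFDerivAt_fst)
  refine (h3.add (iccIntegral.hasFDerivAt.comp p₀ ((ContinuousMap.pointwiseBilin
    (ContinuousLinearMap.id ℝ (F →L[ℝ] E))).hasFDerivAt_of_bilinear h1 h2))).congr_fderiv ?_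
  ext q t
  · simp [picardDeriv, p₀]
  · simp only [picardDeriv, p₀]
    simp
    rfl
  · simp [picardDeriv, p₀]

/-- Solutions of the integral equation of `z' = W(z) a`, depending smoothly on the initial value `z`
near `z₀` and on the parameter `a` near `0`. They exist on `[-2, 2]` because the equation is trivial
for `a = 0`; they come from the inverse function theorem for
`(p, γ) ↦ (p, γ - picardOperator W (p, γ))`, whose derivative at the constant solution is
invertible. -/
theorem exists_picardOperator_eq [CompleteSpace E] [CompleteSpace F] {W : E → F →L[ℝ] E}
    (hW : ContDiff ℝ ∞ W) (z₀ : E) :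
    ∃ γ : E × F → C(Icc (-2 : ℝ) 2, E), γ (z₀, 0) = ContinuousMap.constCLM _ E z₀ ∧
      ∀ᶠ p in 𝓝 (z₀, (0 : F)),
        ContDiffAt ℝ ∞ γ p ∧ γ p = picardOperator W hW.continuous (p, γ p) := by
  set p₀ : (E × F) × C(Icc (-2 : ℝ) 2, E) := ((z₀, 0), ContinuousMap.constCLM _ E z₀) with hp₀
  set Ψ : (E × F) × C(Icc (-2 : ℝ) 2, E) → (E × F) × C(Icc (-2 : ℝ) 2, E) :=
    fun p => (p.1, p.2 - picardOperator W hW.continuous p) with hΨdef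
  have hΨ : ContDiff ℝ ∞ Ψ :=
    contDiff_fst.prodMk (contDiff_snd.sub (contDiff_picardOperator hW))
  set Ψ' : ((E × F) × C(Icc (-2 : ℝ) 2, E)) ≃L[ℝ] ((E × F) × C(Icc (-2 : ℝ) 2, E)) :=
    (ContinuousLinearEquiv.refl ℝ (E × F)).skewProd
      (ContinuousLinearEquiv.refl ℝ C(Icc (-2 : ℝ) 2, E)) (-picardDeriv (W z₀))
  have hΨ' : HasFDerivAt Ψ (Ψ' : _ →L[ℝ] _) p₀ := by
    refine (hasFDerivAt_fst.prodMk
      (hasFDerivAt_snd.sub (hasFDerivAt_picardOperator hW z₀))).congr_fderiv ?_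
    refine ContinuousLinearMap.ext fun q => Prod.ext rfl ?_
    simp [Ψ', sub_eq_add_neg]
  set Φ := hΨ.contDiffAt.toOpenPartialHomeomorph Ψ hΨ' (by simp) with hΦ
  have hbase : Ψ p₀ = ((z₀, 0), 0) := by
    refine Prod.ext rfl ?_
    simp only [hΨdef, hp₀, picardOperator, map_zero]
    simp
  have hp₀s : p₀ ∈ Φ.source := hΨ.contDiffAt.mem_toOpenPartialHomeomorph_source hΨ' (by simp)
  have hp₀t : ((z₀, (0 : F)), (0 : C(Icc (-2 : ℝ) 2, E))) ∈ Φ.target := by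
    rw [← hbase]; exact Φ.map_source hp₀s
  have hsymm : Φ.symm ((z₀, 0), 0) = p₀ := by
    rw [← hbase]; exact Φ.left_inv hp₀s
  have hι : Continuous fun p : E × F => (p, (0 : C(Icc (-2 : ℝ) 2, E))) := by fun_prop
  have hcont : ContinuousAt (fun p : E × F => Φ.symm (p, (0 : C(Icc (-2 : ℝ) 2, E)))) (z₀, 0) :=
    ContinuousAt.comp (f := fun p : E × F => (p, (0 : C(Icc (-2 : ℝ) 2, E))))
      (Φ.continuousAt_symm hp₀t) hι.continuousAt
  refine ⟨fun p => (Φ.symm (p, 0)).2, congrArg Prod.snd hsymm, ?_⟩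
  have e1 : ∀ᶠ p in 𝓝 (z₀, (0 : F)), (p, (0 : C(Icc (-2 : ℝ) 2, E))) ∈ Φ.target :=
    hι.continuousAt.eventually (Φ.open_target.mem_nhds hp₀t)
  have e2 : ∀ᶠ p in 𝓝 (z₀, (0 : F)), fderiv ℝ Ψ (Φ.symm (p, 0)) ∈
      range ((↑) : (((E × F) × C(Icc (-2 : ℝ) 2, E)) ≃L[ℝ] ((E × F) × C(Icc (-2 : ℝ) 2, E))) →
        (((E × F) × C(Icc (-2 : ℝ) 2, E)) →L[ℝ] ((E × F) × C(Icc (-2 : ℝ) 2, E)))) := by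
    have h : ContinuousAt (fun p : E × F => fderiv ℝ Ψ (Φ.symm (p, 0))) (z₀, 0) :=
      ContinuousAt.comp (f := fun p : E × F => Φ.symm (p, (0 : C(Icc (-2 : ℝ) 2, E))))
        (hΨ.continuous_fderiv (by simp)).continuousAt hcont
    refine h.eventually (ContinuousLinearEquiv.isOpen.mem_nhds ?_)
    simp only [hsymm]
    exact ⟨Ψ', hΨ'.fderiv.symm⟩
  filter_upwards [e1, e2] with p hp1 hp2
  obtain ⟨L, hL⟩ := hp2
  have hinv : Ψ (Φ.symm (p, 0)) = (p, 0) := Φ.right_inv hp1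
  refine ⟨?_, ?_⟩
  · have h := Φ.contDiffAt_symm (f₀' := L) (n := ∞) hp1
      (by rw [hL]; exact (hΨ.differentiable (by simp) _).hasFDerivAt) hΨ.contDiffAt
    exact contDiff_snd.contDiffAt.comp p (h.comp p (contDiff_id.prodMk contDiff_const).contDiffAt)
  · have h1 : (Φ.symm (p, 0)).1 = p := congrArg Prod.fst hinv
    have h2 := congrArg Prod.snd hinv
    have h3 : (p, (Φ.symm (p, 0)).2) = Φ.symm (p, 0) := Prod.ext h1.symm rfl
    rw [h3]
    exact sub_eq_zero.1 h2

/-- Smooth dependence on initial values and parameters for the equation `z' = W(z) a`, on the time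
interval `(-2, 2)` and for small `a`. -/
theorem exists_contDiffAt_flow [CompleteSpace F] [FiniteDimensional ℝ E] {U : Set E}
    (hU : IsOpen U) {W : E → F →L[ℝ] E} (hW : ContDiffOn ℝ ∞ W U) {z₀ : E} (hz₀ : z₀ ∈ U) :
    ∃ Z : E × F → ℝ → E, HasFDerivAt (fun p => Z p 1)
        (ContinuousLinearMap.fst ℝ E F + (W z₀).comp (ContinuousLinearMap.snd ℝ E F)) (z₀, 0) ∧
      Z (z₀, 0) 1 = z₀ ∧
      ∀ᶠ p in 𝓝 (z₀, (0 : F)), ContDiffAt ℝ ∞ (fun p => Z p 1) p ∧ Z p 0 = p.1 ∧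
        ∀ t ∈ Ioo (-2 : ℝ) 2, Z p t ∈ U ∧ HasDerivAt (Z p) (W (Z p t) p.2) t := by
  have : CompleteSpace E := FiniteDimensional.complete ℝ E
  obtain ⟨r, hr, hrU⟩ := Metric.isOpen_iff.1 hU z₀ hz₀
  let b : ContDiffBump z₀ := ⟨r / 4, r / 2, by positivity, by linarith⟩
  -- The cut-off coefficient is smooth on all of `E` and agrees with `W` near `z₀`.
  set V : E → F →L[ℝ] E := fun z => b z • W z with hVdef
  have hV : ContDiff ℝ ∞ V := by
    rw [contDiff_iff_contDiffAt]
    intro z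
    by_cases hz : z ∈ U
    · exact b.contDiffAt.smul (hW.contDiffAt (hU.mem_nhds hz))
    · have hz' : z ∉ tsupport b := by
        rw [b.tsupport_eq]
        exact fun h => hz (hrU (Metric.closedBall_subset_ball (by simp [b]; linarith) h))
      have h0 : V =ᶠ[𝓝 z] fun _ => 0 := by
        filter_upwards [(isClosed_tsupport b).isOpen_compl.mem_nhds hz'] with w hw
        simp [hVdef, image_eq_zero_of_notMem_tsupport hw]
      exact contDiffAt_const.congr_of_eventuallyEq h0
  have hVW : ∀ z ∈ Metric.ball z₀ (r / 4), V z = W z := fun z hz => by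
    have : b z = 1 := b.one_of_mem_closedBall (Metric.ball_subset_closedBall hz)
    simp [hVdef, this]
  obtain ⟨γ, hγ₀, hγ⟩ := exists_picardOperator_eq hV z₀
  have hγ₀' := hγ.self_of_nhds
  set Z : E × F → ℝ → E := fun p t => p.1 + iccPrimitive
    (ContinuousMap.pointwiseBilin (ContinuousLinearMap.id ℝ (F →L[ℝ] E))
      (ContinuousMap.postcomp V hV.continuous (γ p)) (ContinuousMap.constCLM _ F p.2)) t with hZ
  have hZγ : ∀ p, γ p = picardOperator V hV.continuous (p, γ p) →
      ∀ t : Icc (-2 : ℝ) 2, Z p t = γ p t := fun p hp t => by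
    conv_rhs => rw [hp]
    rfl
  have h1mem : (1 : ℝ) ∈ Icc (-2 : ℝ) 2 := by norm_num
  have hev : (fun p => Z p 1) =ᶠ[𝓝 (z₀, (0 : F))]
      fun p => ContinuousMap.evalCLM ℝ (⟨1, h1mem⟩ : Icc (-2 : ℝ) 2) (γ p) := by
    filter_upwards [hγ] with p hp
    exact hZγ p hp.2 ⟨1, h1mem⟩
  have hderiv : HasFDerivAt γ (picardDeriv (V z₀)) (z₀, 0) := by
    have hd : HasFDerivAt γ (fderiv ℝ γ (z₀, 0)) (z₀, 0) :=
      (hγ₀'.1.differentiableAt (by simp)).hasFDerivAt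
    have hN := hasFDerivAt_picardOperator (F := F) hV z₀
    rw [← hγ₀] at hN
    have hc := hN.comp (f := fun p : E × F => (p, γ p)) (z₀, (0 : F)) ((hasFDerivAt_id _).prodMk hd)
    refine (hc.congr_of_eventuallyEq (hγ.mono fun p hp => hp.2)).congr_fderiv ?_
    ext q <;> simp
  refine ⟨Z, ?_, ?_, ?_⟩
  · refine (((ContinuousLinearMap.hasFDerivAt _).comp _ hderiv).congr_of_eventuallyEq
      hev).congr_fderiv ?_
    ext q
    · simp [picardDeriv]
    · have : V z₀ = W z₀ := hVW z₀ (Metric.mem_ball_self (by positivity))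
      have h2 := iccPrimitive_const (W z₀ q) 1
      simp only [picardDeriv, this]
      simp [iccIntegral_apply]
      rw [one_smul] at h2
      exact h2
  · rw [hev.eq_of_nhds, hγ₀]
    rfl
  · have hcγ : ContinuousAt γ (z₀, 0) := hγ₀'.1.continuousAt
    have e1 : ∀ᶠ p in 𝓝 (z₀, (0 : F)), γ p ∈ Metric.ball (γ (z₀, 0)) (r / 4) :=
      hcγ.eventually (Metric.ball_mem_nhds _ (by positivity))
    filter_upwards [hγ, hev.eventually_nhds, e1] with p hp hevp hp1
    refine ⟨((ContinuousLinearMap.contDiff _).contDiffAt.comp p hp.1).congr_of_eventuallyEq hevp,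
      by simp [hZ, iccPrimitive], fun t ht => ?_⟩
    have ht' : t ∈ Icc (-2 : ℝ) 2 := Ioo_subset_Icc_self ht
    have hZt := hZγ p hp.2 ⟨t, ht'⟩
    have hb : Z p t ∈ Metric.ball z₀ (r / 4) := by
      rw [hZt]
      rw [hγ₀] at hp1
      refine lt_of_le_of_lt ?_ (Metric.mem_ball.1 hp1)
      exact ContinuousMap.dist_apply_le_dist (f := γ p) (g := ContinuousMap.constCLM _ E z₀)
        (⟨t, ht'⟩ : Icc (-2 : ℝ) 2)
    refine ⟨hrU (Metric.ball_subset_ball (by linarith) hb), ?_⟩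
    rw [← hVW _ hb]
    refine ((hasDerivAt_iccPrimitive _ t).const_add p.1).congr_deriv ?_
    rw [projIcc_of_mem _ ht']
    exact congrArg (fun z => V z p.2) hZt.symm

end Flow

/-! ### Families of curves in the source fibres and their left invariant fields -/

namespace LieGroupoid

section FibreFamily

variable {EG : Type u} [NormedAddCommGroup EG] [NormedSpace ℝ EG]
  {HG : Type*} [TopologicalSpace HG] {IG : ModelWithCorners ℝ EG HG}
  {EM : Type*} [NormedAddCommGroup EM] [NormedSpace ℝ EM]
  {HM : Type*} [TopologicalSpace HM] {IM : ModelWithCorners ℝ EM HM}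
  {𝒢 : Type*} [TopologicalSpace 𝒢] [ChartedSpace HG 𝒢] [IsManifold IG ∞ 𝒢]
  {M : Type*} [TopologicalSpace M] [ChartedSpace HM M] [IsManifold IM ∞ M]
  {F : Type u} [NormedAddCommGroup F] [NormedSpace ℝ F]

theorem contMDiffOn_mul_left (G : LieGroupoid IG IM 𝒢 M) (g : 𝒢) :
    ContMDiffOn IG IG ∞ (G.mul g) (G.src ⁻¹' {G.tgt g}) :=
  G.contMDiffOn_mul.comp (contMDiffOn_const.prodMk contMDiffOn_id) fun _ hh => Eq.symm hh

variable (F) in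
/-- A smooth family of maps `F → α⁻¹(x)`, `x ∈ M`, from a vector space to the source fibres, sending
`0` to the unit at `x`, and constant unless `x` lies in a fixed compact set. -/
structure FibreFamily (G : LieGroupoid IG IM 𝒢 M) where
  /-- the underlying map, as a function of two variables -/
  toFun : M → F → 𝒢
  contMDiff : ContMDiff (IM.prod 𝓘(ℝ, F)) IG ∞ fun p : M × F => toFun p.1 p.2
  src_apply : ∀ x v, G.src (toFun x v) = x
  apply_zero : ∀ x, toFun x 0 = G.unit x
  /-- the compact set outside of which the family is constant -/
  supp : Set M
  isCompact_supp : IsCompact supp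
  isClosed_supp : IsClosed supp
  apply_of_notMem : ∀ x ∉ supp, ∀ v, toFun x v = G.unit x

namespace FibreFamily

variable {G : LieGroupoid IG IM 𝒢 M} (D : FibreFamily F G)

/-- Right multiplication by the family, `(g, v) ↦ g D(β(g), v)`. It is always a product of
composable arrows. -/
def act (g : 𝒢) (v : F) : 𝒢 := G.mul g (D.toFun (G.tgt g) v)

theorem contMDiff_act :
    ContMDiff (IG.prod 𝓘(ℝ, F)) IG ∞ fun p : 𝒢 × F => D.act p.1 p.2 := by
  have h1 : ContMDiff (IG.prod 𝓘(ℝ, F)) (IM.prod 𝓘(ℝ, F)) ∞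
      fun p : 𝒢 × F => (G.tgt p.1, p.2) :=
    (G.isSubmersion_tgt.contMDiff.comp contMDiff_fst).prodMk contMDiff_snd
  exact G.contMDiffOn_mul.comp_contMDiff (contMDiff_fst.prodMk (D.contMDiff.comp h1))
    fun p => (D.src_apply _ _).symm

@[simp]
theorem act_zero (g : 𝒢) : D.act g 0 = g := by
  rw [act, D.apply_zero, G.mul_unit]

theorem src_act (g : 𝒢) (v : F) : G.src (D.act g v) = G.src g :=
  G.src_mul _ _ (D.src_apply _ _).symm

theorem act_mul {g h : 𝒢} (hgh : G.tgt g = G.src h) (v : F) :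
    D.act (G.mul g h) v = G.mul g (D.act h v) := by
  rw [act, act, G.tgt_mul _ _ hgh, G.mul_assoc _ _ _ hgh (D.src_apply _ _).symm]

theorem act_unit (x : M) (v : F) : D.act (G.unit x) v = D.toFun x v := by
  have h := G.unit_mul (D.toFun x v)
  rw [D.src_apply] at h
  rw [act, G.tgt_unit, h]

theorem act_of_notMem {g : 𝒢} (hg : G.tgt g ∉ D.supp) (v : F) : D.act g v = g := by
  rw [act, D.apply_of_notMem _ hg, G.mul_unit]

theorem contMDiff_act_right (g : 𝒢) : ContMDiff 𝓘(ℝ, F) IG ∞ (D.act g) :=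
  D.contMDiff_act.comp (contMDiff_const.prodMk contMDiff_id)

/-- The derivative at `0` of `v ↦ g D(β(g), v)`. Its values are tangent vectors at `g`. -/
noncomputable def actDeriv (g : 𝒢) : F →L[ℝ] TangentSpace IG g :=
  mfderiv 𝓘(ℝ, F) IG (D.act g) 0

theorem hasMFDerivAt_act (g : 𝒢) : HasMFDerivAt 𝓘(ℝ, F) IG (D.act g) 0 (D.actDeriv g) :=
  ((D.contMDiff_act_right g).mdifferentiable (by simp) 0).hasMFDerivAt

/-- The fields `g ↦ D.actDeriv g a` are smooth: they are the image of a smooth section of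
`T(𝒢 × F)` under the tangent map of the action. -/
theorem contMDiff_actDeriv (a : F) :
    ContMDiff IG IG.tangent ∞ fun g => (⟨g, D.actDeriv g a⟩ : TangentBundle IG 𝒢) := by
  have h1 : ContMDiff IG ((IG.prod 𝓘(ℝ, F)).tangent) ∞ fun g : 𝒢 =>
      (equivTangentBundleProd IG 𝒢 𝓘(ℝ, F) F).symm (⟨g, 0⟩, ⟨0, a⟩) :=
    contMDiff_equivTangentBundleProd_symm.comp
      ((Bundle.contMDiff_zeroSection ℝ (TangentSpace IG : 𝒢 → Type _)).prodMk contMDiff_const)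
  have h2 := (D.contMDiff_act.contMDiff_tangentMap (m := ∞) (by simp)).comp h1
  refine h2.congr fun g => ?_
  -- `D.act g 0 = g` is only a propositional equality, so the base points are generalized.
  have key : ∀ (g' : 𝒢) (w : EG), g' = g → w = D.actDeriv g a →
      (⟨g, D.actDeriv g a⟩ : TangentBundle IG 𝒢) = ⟨g', w⟩ := by
    rintro g' w rfl rfl
    rfl
  refine key _ _ (D.act_zero g) ?_
  have hc : HasMFDerivAt 𝓘(ℝ, F) IG (D.act g) 0
      ((mfderiv (IG.prod 𝓘(ℝ, F)) IG (fun p : 𝒢 × F => D.act p.1 p.2) (g, 0)).comp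
        (mfderiv 𝓘(ℝ, F) (IG.prod 𝓘(ℝ, F)) (fun v : F => (g, v)) 0)) :=
    HasMFDerivAt.comp (g := fun p : 𝒢 × F => D.act p.1 p.2) (f := fun v : F => (g, v)) 0
      (D.contMDiff_act.mdifferentiable (by simp) _).hasMFDerivAt
      ((mdifferentiableAt_const.prodMk mdifferentiableAt_id).hasMFDerivAt)
  have he := hasMFDerivAt_unique (D.hasMFDerivAt_act g) hc
  rw [he, mfderiv_prod_right]
  rfl

theorem mfderiv_src_actDeriv (g : 𝒢) (a : F) :
    mfderiv IG IM G.src g (D.actDeriv g a) = 0 := by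
  have h1 : HasMFDerivAt IG IM G.src (D.act g 0) (mfderiv IG IM G.src (D.act g 0)) :=
    (G.isSubmersion_src.contMDiff.mdifferentiable (by simp) _).hasMFDerivAt
  have h2 := HasMFDerivAt.comp (0 : F) h1 (D.hasMFDerivAt_act g)
  have h3 : HasMFDerivAt 𝓘(ℝ, F) IM (G.src ∘ D.act g) 0 (0 : F →L[ℝ] EM) := by
    have : G.src ∘ D.act g = fun _ => G.src g := funext fun v => D.src_act g v
    rw [this]
    exact hasMFDerivAt_const _ _
  have h4 := hasMFDerivAt_unique h2 h3
  rw [D.act_zero] at h4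
  exact DFunLike.congr_fun h4 a

/-- Left translations preserve the fields `g ↦ D.actDeriv g a`. The derivative of the left
translation within the source fibre may be any of the possible ones. -/
theorem apply_actDeriv {g h : 𝒢} (hgh : G.tgt g = G.src h) {L : EG →L[ℝ] EG}
    (hL : HasMFDerivWithinAt IG IG (G.mul g) (G.src ⁻¹' {G.tgt g}) h L) (a : F) :
    L (D.actDeriv h a) = D.actDeriv (G.mul g h) a := by
  have h1 : HasMFDerivWithinAt IG IG (G.mul g) (G.src ⁻¹' {G.tgt g}) (D.act h 0) L := by
    rw [D.act_zero]; exact hL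
  have h2 := HasMFDerivWithinAt.comp (0 : F) h1
    (D.hasMFDerivAt_act h).hasMFDerivWithinAt (s := univ)
    (fun v _ => by simp [D.src_act, hgh])
  rw [hasMFDerivWithinAt_univ] at h2
  have h3 : G.mul g ∘ D.act h = D.act (G.mul g h) := funext fun v => (D.act_mul hgh v).symm
  rw [h3] at h2
  exact DFunLike.congr_fun (hasMFDerivAt_unique h2 (D.hasMFDerivAt_act _)) a

/-- The section of the Lie algebroid whose value at `x` is the derivative of `v ↦ D(x, v)` at `0` in
the direction `a`. -/
noncomputable def algebroidSection (a : F) : AlgebroidSection G where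
  toFun x := D.actDeriv (G.unit x) a
  mfderiv_src _ := D.mfderiv_src_actDeriv _ _
  contMDiff' := (D.contMDiff_actDeriv a).comp G.contMDiff_unit

theorem leftInvariantField_algebroidSection (a : F) (g : 𝒢) :
    (D.algebroidSection a).leftInvariantField g = D.actDeriv g a := by
  have hsrc : G.tgt g = G.src (G.unit (G.tgt g)) := (G.src_unit _).symm
  have h := D.apply_actDeriv hsrc
    (((G.contMDiffOn_mul_left g).mdifferentiableOn (by simp) _ hsrc.symm).hasMFDerivWithinAt) a
  rw [G.mul_unit] at h
  exact h

theorem actDeriv_of_notMem {g : 𝒢} (hg : G.tgt g ∉ D.supp) : D.actDeriv g = 0 := by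
  have h : D.act g = fun _ => g := funext fun v => D.act_of_notMem hg v
  have h1 := D.hasMFDerivAt_act g
  rw [h] at h1
  exact hasMFDerivAt_unique h1 (hasMFDerivAt_const _ _)

theorem hasCompactSupport_algebroidSection (a : F) :
    (D.algebroidSection a).HasCompactSupport := by
  refine D.isCompact_supp.of_isClosed_subset isClosed_closure
    (closure_minimal (fun x hx => ?_) D.isClosed_supp)
  by_contra h
  refine hx ?_
  change D.actDeriv (G.unit x) a = 0
  rw [D.actDeriv_of_notMem (by rwa [G.tgt_unit])]
  rfl

end FibreFamily

end FibreFamily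

end LieGroupoid

/-! ### Existence of families parametrizing a source fibre -/

namespace LieGroupoid

section Existence

variable {EG : Type u} [NormedAddCommGroup EG] [NormedSpace ℝ EG]
  {HG : Type*} [TopologicalSpace HG] {IG : ModelWithCorners ℝ EG HG}
  {EM : Type*} [NormedAddCommGroup EM] [NormedSpace ℝ EM]
  {HM : Type*} [TopologicalSpace HM] {IM : ModelWithCorners ℝ EM HM}
  {𝒢 : Type*} [TopologicalSpace 𝒢] [ChartedSpace HG 𝒢] [IsManifold IG ∞ 𝒢]
  {M : Type*} [TopologicalSpace M] [ChartedSpace HM M] [IsManifold IM ∞ M]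

/-- Near a unit there is a `FibreFamily` that is a local parametrization of the source fibre, in the
sense that a coordinate `ρ`, injective on the source fibres near the unit, is a left inverse of it.
It is read off from the charts in which the source map is a linear projection, after multiplication
with cut-off functions both on `M` and on `F`. -/
theorem exists_fibreFamily [FiniteDimensional ℝ EG] [IG.Boundaryless] [FiniteDimensional ℝ EM]
    [T2Space M] (G : LieGroupoid IG IM 𝒢 M) (x₀ : M) :
    ∃ (F : Type u) (_ : NormedAddCommGroup F) (_ : NormedSpace ℝ F) (_ : FiniteDimensional ℝ F)
      (D : FibreFamily F G) (ρ : 𝒢 → F),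
      ContMDiffAt IG 𝓘(ℝ, F) ∞ ρ (G.unit x₀) ∧ (∀ᶠ v in 𝓝 (0 : F), ρ (D.toFun x₀ v) = v) ∧
      ∃ N ∈ 𝓝 (G.unit x₀), ∀ k ∈ N, ∀ k' ∈ N, G.src k = G.src k' → ρ k = ρ k' → k = k' := by
  classical
  obtain ⟨F, _, _, hF⟩ := G.isSubmersion_src
  have h : Manifold.IsSubmersionAtOfComplement F IG IM ∞ G.src (G.unit x₀) := hF _
  have hfin : FiniteDimensional ℝ F :=
    Module.Finite.of_surjective ((LinearMap.snd ℝ EM F).comp h.equiv.toLinearEquiv.toLinearMap)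
      (Prod.snd_surjective.comp h.equiv.surjective)
  set φ := h.domChart.extend IG with hφ
  set ψ := h.codChart.extend IM with hψ
  set e := h.equiv with he
  have hφs : φ.source = h.domChart.source := h.domChart.extend_source
  have hψs : ψ.source = h.codChart.source := h.codChart.extend_source
  have hsrc : ∀ k ∈ φ.source, G.src k ∈ ψ.source := fun k hk => by
    rw [hψs]; exact h.source_subset_preimage_source (by rwa [← hφs])
  have hchart : ∀ k ∈ φ.source, (e (φ k)).1 = ψ (G.src k) := fun k hk => by
    have := h.writtenInCharts (φ.map_source hk)
    simp only [Function.comp_apply] at this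
    rw [φ.left_inv hk] at this
    exact this.symm
  have hx₀ : G.unit x₀ ∈ φ.source := by rw [hφs]; exact h.mem_domChart_source
  have hφat : ∀ k ∈ φ.source, ContMDiffAt IG 𝓘(ℝ, EG) ∞ φ k := fun k hk =>
    h.domChart.contMDiffAt_extend h.domChart_mem_maximalAtlas (by rwa [← hφs])
  have hψat : ∀ y ∈ ψ.source, ContMDiffAt IM 𝓘(ℝ, EM) ∞ ψ y := fun y hy =>
    h.codChart.contMDiffAt_extend h.codChart_mem_maximalAtlas (by rwa [← hψs])
  have hφo : IsOpen φ.target := h.domChart.isOpen_extend_target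
  have hφsymm : ∀ z ∈ φ.target, ContMDiffAt 𝓘(ℝ, EG) IG ∞ φ.symm z := fun z hz => by
    refine (contMDiffOn_extend_symm h.domChart_mem_maximalAtlas).contMDiffAt ?_
    rw [← h.domChart.extend_target']
    exact hφo.mem_nhds hz
  -- In the charts of the submersion, `B (y, w)` is the unit at `y` moved by `w` along the fibre.
  set A : M × F → EG := fun p => e.symm (ψ p.1, (e (φ (G.unit p.1))).2 + p.2) with hA
  set B : M × F → 𝒢 := fun p => φ.symm (A p) with hB
  have hAat : ∀ p : M × F, G.unit p.1 ∈ φ.source →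
      ContMDiffAt (IM.prod 𝓘(ℝ, F)) 𝓘(ℝ, EG) ∞ A p := fun p hp => by
    have h1 : ContMDiffAt (IM.prod 𝓘(ℝ, F)) 𝓘(ℝ, EM) ∞ (fun p : M × F => ψ p.1) p :=
      (hψat p.1 (by simpa [G.src_unit] using hsrc _ hp)).comp p contMDiffAt_fst
    have h2 : ContMDiffAt (IM.prod 𝓘(ℝ, F)) 𝓘(ℝ, EG) ∞ (fun p : M × F => φ (G.unit p.1)) p :=
      ContMDiffAt.comp p (hφat _ hp) (G.contMDiff_unit.contMDiffAt.comp p contMDiffAt_fst)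
    have h3 : ContMDiffAt (IM.prod 𝓘(ℝ, F)) 𝓘(ℝ, F) ∞
        (fun p : M × F => (e (φ (G.unit p.1))).2) p :=
      ((contDiff_snd.comp e.contDiff).contMDiff.contMDiffAt).comp p h2
    exact (e.symm.contDiff.contMDiff.contMDiffAt).comp p
      (h1.prodMk_space (h3.add contMDiffAt_snd))
  have hA0 : ∀ y, G.unit y ∈ φ.source → A (y, 0) = φ (G.unit y) := fun y hy => by
    have : (ψ y, (e (φ (G.unit y))).2) = e (φ (G.unit y)) :=
      Prod.ext (by rw [hchart _ hy, G.src_unit]) rfl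
    simp only [hA, add_zero, this, e.symm_apply_apply]
  have hB0 : ∀ y, G.unit y ∈ φ.source → B (y, 0) = G.unit y := fun y hy => by
    simp only [hB, hA0 y hy, φ.left_inv hy]
  have hsrcB : ∀ p : M × F, G.unit p.1 ∈ φ.source → A p ∈ φ.target → G.src (B p) = p.1 :=
    fun p hp hp' => by
      have hk : B p ∈ φ.source := φ.map_target hp'
      have h1 := hchart _ hk
      have h2 : φ (B p) = A p := φ.right_inv hp'
      rw [h2] at h1
      simp only [hA, e.apply_symm_apply] at h1
      exact (ψ.injOn (by simpa [G.src_unit] using hsrc _ hp) (hsrc _ hk) h1).symm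
  -- A neighbourhood of `(x₀, 0)` on which `B` is defined.
  have hO : ∀ᶠ p in 𝓝 ((x₀, 0) : M × F), G.unit p.1 ∈ φ.source ∧ A p ∈ φ.target := by
    have h1 : ContinuousAt (fun p : M × F => G.unit p.1) (x₀, 0) :=
      G.contMDiff_unit.continuous.continuousAt.comp continuousAt_fst
    refine (h1.eventually (h.domChart.isOpen_extend_source.mem_nhds hx₀)).and ?_
    refine (hAat (x₀, 0) hx₀).continuousAt.eventually (hφo.mem_nhds ?_)
    rw [hA0 _ hx₀]
    exact φ.map_source hx₀
  rw [nhds_prod_eq, Filter.eventually_prod_iff] at hO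
  obtain ⟨pM, hpM, pF, hpF, hO⟩ := hO
  obtain ⟨N, hNp, hNo, hxN⟩ := eventually_nhds_iff.1 hpM
  obtain ⟨R, hR, hRF⟩ := Metric.eventually_nhds_iff_ball.1 hpF
  obtain ⟨χ, -, hχ⟩ := (SmoothBumpFunction.nhds_basis_tsupport (I := IM) x₀).mem_iff.1
    (hNo.mem_nhds hxN)
  let b : ContDiffBump (0 : F) := ⟨R / 4, R / 2, by positivity, by linarith⟩
  -- The cut-off argument of `B` never leaves the ball where `B` is defined.
  have hη : ∀ (y : M) (v : F), χ y • b v • v ∈ Metric.ball (0 : F) R := fun y v => by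
    by_cases hv : b v = 0
    · simp [hv, hR]
    · have hv' : v ∈ Metric.ball (0 : F) (R / 2) := by
        rw [← b.support_eq]; exact hv
      rw [mem_ball_zero_iff] at hv' ⊢
      rw [smul_smul, norm_smul, Real.norm_eq_abs, abs_of_nonneg (mul_nonneg χ.nonneg b.nonneg)]
      have : χ y * b v ≤ 1 := mul_le_one₀ χ.le_one b.nonneg b.le_one
      nlinarith [norm_nonneg v]
  have hgood : ∀ y ∈ N, ∀ v : F,
      G.unit y ∈ φ.source ∧ A (y, χ y • b v • v) ∈ φ.target := fun y hy v =>
    hO (hNp y hy) (hRF _ (hη y v))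
  set τ : M → F → 𝒢 := fun y v =>
    if y ∈ tsupport χ then B (y, χ y • b v • v) else G.unit y with hτ
  have hτN : ∀ y ∈ N, ∀ v, τ y v = B (y, χ y • b v • v) := fun y hy v => by
    by_cases hy' : y ∈ tsupport χ
    · simp [hτ, hy']
    · have : χ y = 0 := image_eq_zero_of_notMem_tsupport hy'
      simp only [hτ, hy', if_false, this, zero_smul]
      exact (hB0 y (hgood y hy v).1).symm
  have hτc : ∀ y ∉ tsupport χ, ∀ v, τ y v = G.unit y := fun y hy v => by simp [hτ, hy]
  let D : FibreFamily F G :=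
    { toFun := τ
      contMDiff := by
        rintro ⟨y, v⟩
        by_cases hy : y ∈ tsupport χ
        · have hyN := hχ hy
          have h1 : ContMDiffAt (IM.prod 𝓘(ℝ, F)) (IM.prod 𝓘(ℝ, F)) ∞
              (fun p : M × F => (p.1, χ p.1 • b p.2 • p.2)) (y, v) := by
            refine contMDiffAt_fst.prodMk ?_
            have hb : ContMDiff 𝓘(ℝ, F) 𝓘(ℝ, F) ∞ fun v : F => b v • v :=
              (b.contDiff.smul contDiff_id).contMDiff
            exact (χ.contMDiff.contMDiffAt.comp _ contMDiffAt_fst).smul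
              (hb.contMDiffAt.comp _ contMDiffAt_snd)
          have h2 : ContMDiffAt (IM.prod 𝓘(ℝ, F)) IG ∞ B (y, χ y • b v • v) :=
            (hφsymm _ (hgood y hyN v).2).comp _ (hAat _ (hgood y hyN v).1)
          refine (ContMDiffAt.comp (y, v) h2 h1).congr_of_eventuallyEq ?_
          filter_upwards [continuousAt_fst.eventually (hNo.mem_nhds hyN)] with p hp
          exact hτN p.1 hp p.2
        · refine (G.contMDiff_unit.contMDiffAt.comp (y, v) contMDiffAt_fst).congr_of_eventuallyEq ?_
          filter_upwards [continuousAt_fst.eventually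
            ((isClosed_tsupport χ).isOpen_compl.mem_nhds hy)] with p hp
          exact hτc p.1 hp p.2
      src_apply := fun y v => by
        by_cases hy : y ∈ tsupport χ
        · rw [hτN y (hχ hy) v]
          exact hsrcB _ (hgood y (hχ hy) v).1 (hgood y (hχ hy) v).2
        · rw [hτc y hy, G.src_unit]
      apply_zero := fun y => by
        by_cases hy : y ∈ tsupport χ
        · rw [hτN y (hχ hy), smul_zero, smul_zero]
          exact hB0 y (hgood y (hχ hy) 0).1
        · rw [hτc y hy]
      supp := tsupport χ
      isCompact_supp := χ.hasCompactSupport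
      isClosed_supp := isClosed_tsupport χ
      apply_of_notMem := hτc }
  refine ⟨F, _, _, hfin, D, fun k => (e (φ k)).2 - (e (φ (G.unit x₀))).2, ?_, ?_, φ.source,
    h.domChart.isOpen_extend_source.mem_nhds hx₀, ?_⟩
  · exact (((contDiff_snd.comp e.contDiff).sub contDiff_const).contMDiff.contMDiffAt).comp _
      (hφat _ hx₀)
  · filter_upwards [Metric.closedBall_mem_nhds (0 : F) (show 0 < R / 4 by positivity)] with v hv
    have hbv : b v = 1 := b.one_of_mem_closedBall hv
    have h1 : τ x₀ v = B (x₀, χ x₀ • b v • v) := hτN x₀ hxN v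
    have h2 := (hgood x₀ hxN v).2
    change (e (φ (τ x₀ v))).2 - _ = v
    rw [h1]
    simp only [hB]
    rw [φ.right_inv h2]
    simp [hA, hbv]
  · intro k hk k' hk' h1 h2
    refine φ.injOn hk hk' (e.injective (Prod.ext ?_ (sub_left_injective h2)))
    rw [hchart k hk, hchart k' hk', h1]

end Existence

end LieGroupoid

/-! ### Local integral curves -/

namespace LieGroupoid.FibreFamily

section LocalFlow

variable {EG : Type u} [NormedAddCommGroup EG] [NormedSpace ℝ EG]
  {HG : Type*} [TopologicalSpace HG] {IG : ModelWithCorners ℝ EG HG}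
  {EM : Type*} [NormedAddCommGroup EM] [NormedSpace ℝ EM]
  {HM : Type*} [TopologicalSpace HM] {IM : ModelWithCorners ℝ EM HM}
  {𝒢 : Type*} [TopologicalSpace 𝒢] [ChartedSpace HG 𝒢] [IsManifold IG ∞ 𝒢]
  {M : Type*} [TopologicalSpace M] [ChartedSpace HM M] [IsManifold IM ∞ M]
  {F : Type u} [NormedAddCommGroup F] [NormedSpace ℝ F]
  {G : LieGroupoid IG IM 𝒢 M} (D : FibreFamily F G)

/-- For base points near `y₀` and small `a`, the integral curve of `g ↦ D.actDeriv g a` that starts at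
the unit of the base point exists on `(-2, 2)`, its value at time `1` is smooth in both variables,
and to first order in `a` it is `D.actDeriv (G.unit y₀) a`. -/
theorem exists_contMDiffAt_flow [FiniteDimensional ℝ EG] [IG.Boundaryless] [CompleteSpace F]
    (y₀ : M) :
    ∃ S : M × F → 𝒢, S (y₀, 0) = G.unit y₀ ∧
      HasMFDerivAt 𝓘(ℝ, F) IG (fun a => S (y₀, a)) 0
        (D.actDeriv (G.unit y₀) : F →L[ℝ] EG) ∧
      ∀ᶠ p in 𝓝 (y₀, (0 : F)), ContMDiffAt (IM.prod 𝓘(ℝ, F)) IG ∞ S p ∧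
        ∃ γ : ℝ → 𝒢, γ 0 = G.unit p.1 ∧
          IsMIntegralCurveOn (I := IG) γ (fun g => D.actDeriv g p.2) (Ioo (-2) 2) ∧
          γ 1 = S p := by
  set φ := extChartAt IG (G.unit y₀) with hφ
  set z₀ : EG := φ (G.unit y₀) with hz₀def
  have hUo : IsOpen φ.target := isOpen_extChartAt_target _
  have hz₀ : z₀ ∈ φ.target := mem_extChartAt_target _
  have hleft : φ.symm z₀ = G.unit y₀ := extChartAt_to_inv _
  have hφat : ∀ k ∈ φ.source, ContMDiffAt IG 𝓘(ℝ, EG) ∞ φ k := fun k hk =>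
    contMDiffAt_extChartAt' (by rwa [← extChartAt_source IG])
  have hφsymm : ∀ z ∈ φ.target, ContMDiffAt 𝓘(ℝ, EG) IG ∞ φ.symm z := fun z hz =>
    (contMDiffOn_extChartAt_symm _).contMDiffAt (hUo.mem_nhds hz)
  set μ : EG → F → EG := fun z v => φ (D.act (φ.symm z) v) with hμdef
  have hμ : ∀ z ∈ φ.target, ContDiffAt ℝ ∞ (Function.uncurry μ) (z, 0) := fun z hz => by
    have h1 : ContMDiffAt 𝓘(ℝ, EG × F) IG ∞ (fun p : EG × F => φ.symm p.1) (z, 0) :=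
      (hφsymm z hz).comp (z, (0 : F)) contDiff_fst.contMDiff.contMDiffAt
    have h2 : ContMDiffAt 𝓘(ℝ, EG × F) (IG.prod 𝓘(ℝ, F)) ∞
        (fun p : EG × F => (φ.symm p.1, p.2)) (z, 0) :=
      h1.prodMk contDiff_snd.contMDiff.contMDiffAt
    have h3 : ContMDiffAt 𝓘(ℝ, EG × F) IG ∞
        (fun p : EG × F => D.act (φ.symm p.1) p.2) (z, 0) :=
      D.contMDiff_act.contMDiffAt.comp (z, (0 : F)) h2
    have h4 : D.act (φ.symm z) 0 ∈ φ.source := by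
      rw [D.act_zero]
      exact φ.map_target hz
    exact (ContMDiffAt.comp (I' := IG) (f := fun p : EG × F => D.act (φ.symm p.1) p.2)
      (z, (0 : F)) (hφat _ h4) h3).contDiffAt
  -- `W z a` is the field `g ↦ D.actDeriv g a` in the chart.
  set W : EG → F →L[ℝ] EG := fun z => fderiv ℝ (μ z) 0 with hWdef
  have hW : ContDiffOn ℝ ∞ W φ.target := fun z hz =>
    (ContDiffAt.fderiv (n := ∞) (m := ∞) (f := μ) (g := fun _ => (0 : F)) (hμ z hz)
      contDiffAt_const (by simp)).contDiffWithinAt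
  have hsymmD : ∀ z ∈ φ.target, HasMFDerivAt 𝓘(ℝ, EG) IG φ.symm z
      (mfderiv 𝓘(ℝ, EG) IG φ.symm z) := fun z hz =>
    ((hφsymm z hz).mdifferentiableAt (by simp)).hasMFDerivAt
  have hL : ∀ z ∈ φ.target, ∀ a, mfderiv 𝓘(ℝ, EG) IG φ.symm z (W z a) =
      D.actDeriv (φ.symm z) a := fun z hz a => by
    have hz0 : μ z 0 = z := by simp [hμdef, φ.right_inv hz]
    have h1 : HasFDerivAt (μ z) (W z) 0 := by
      have : DifferentiableAt ℝ (μ z) 0 :=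
        DifferentiableAt.comp (g := Function.uncurry μ) (f := fun v : F => (z, v)) 0
          ((hμ z hz).differentiableAt (by simp)) (by fun_prop)
      exact this.hasFDerivAt
    have h2 : HasMFDerivAt 𝓘(ℝ, EG) IG φ.symm (μ z 0) (mfderiv 𝓘(ℝ, EG) IG φ.symm z) := by
      rw [hz0]; exact hsymmD z hz
    have h3 := HasMFDerivAt.comp (0 : F) h2 h1.hasMFDerivAt
    have h4 : D.act (φ.symm z) =ᶠ[𝓝 0] φ.symm ∘ μ z := by
      have hc : ContinuousAt (D.act (φ.symm z)) 0 :=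
        (D.contMDiff_act_right _).continuous.continuousAt
      have hs : φ.source ∈ 𝓝 (D.act (φ.symm z) 0) := by
        rw [D.act_zero]
        exact (isOpen_extChartAt_source _).mem_nhds (φ.map_target hz)
      filter_upwards [hc.eventually hs] with v hv
      exact (φ.left_inv hv).symm
    exact DFunLike.congr_fun
      (hasMFDerivAt_unique (h3.congr_of_eventuallyEq h4) (D.hasMFDerivAt_act _)) a
  obtain ⟨Z, hZd, hZ1, hZ⟩ := exists_contDiffAt_flow hUo hW hz₀
  set q : M × F → EG × F := fun p => (φ (G.unit p.1), p.2) with hq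
  have hq0 : q (y₀, 0) = (z₀, 0) := rfl
  have hqat : ∀ p : M × F, G.unit p.1 ∈ φ.source →
      ContMDiffAt (IM.prod 𝓘(ℝ, F)) 𝓘(ℝ, EG × F) ∞ q p := fun p hp => by
    have h2 : ContMDiffAt (IM.prod 𝓘(ℝ, F)) 𝓘(ℝ, EG) ∞ (fun p : M × F => φ (G.unit p.1)) p :=
      ContMDiffAt.comp p (hφat _ hp) (G.contMDiff_unit.contMDiffAt.comp p contMDiffAt_fst)
    exact h2.prodMk_space contMDiffAt_snd
  have hunit : ∀ᶠ p in 𝓝 (y₀, (0 : F)), G.unit p.1 ∈ φ.source := by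
    have h1 : ContinuousAt (fun p : M × F => G.unit p.1) (y₀, 0) :=
      G.contMDiff_unit.continuous.continuousAt.comp continuousAt_fst
    exact h1.eventually ((isOpen_extChartAt_source _).mem_nhds (mem_extChartAt_source _))
  have hZq : ∀ᶠ p in 𝓝 (y₀, (0 : F)), _ :=
    (hqat (y₀, 0) hunit.self_of_nhds).continuousAt.eventually (hq0 ▸ hZ)
  refine ⟨fun p => φ.symm (Z (q p) 1), ?_, ?_, ?_⟩
  · change φ.symm (Z (q (y₀, 0)) 1) = _
    rw [hq0, hZ1, hleft]
  · have h1 : HasFDerivAt (fun a : F => Z (z₀, a) 1) (W z₀) 0 := by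
      refine (HasFDerivAt.comp (g := fun p : EG × F => Z p 1) (f := fun a : F => (z₀, a)) 0 hZd
        (hasFDerivAt_prodMk_right z₀ 0)).congr_fderiv ?_
      ext a
      simp
    have h2 : HasMFDerivAt 𝓘(ℝ, EG) IG φ.symm (Z (z₀, 0) 1) (mfderiv 𝓘(ℝ, EG) IG φ.symm z₀) := by
      rw [hZ1]; exact hsymmD z₀ hz₀
    have h3 := HasMFDerivAt.comp (0 : F) h2 h1.hasMFDerivAt
    have h4 : (mfderiv 𝓘(ℝ, EG) IG φ.symm z₀ : EG →L[ℝ] EG).comp (W z₀) =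
        (D.actDeriv (G.unit y₀) : F →L[ℝ] EG) := by
      ext a
      have := hL z₀ hz₀ a
      rw [hleft] at this
      exact this
    rw [← h4]
    exact h3
  · filter_upwards [hZq, hunit] with p hp hpu
    obtain ⟨hp1, hp0, hp2⟩ := hp
    refine ⟨?_, fun t => φ.symm (Z (q p) t), ?_, ?_, rfl⟩
    · have h1 : ContMDiffAt 𝓘(ℝ, EG × F) 𝓘(ℝ, EG) ∞ (fun p => Z p 1) (q p) := hp1.contMDiffAt
      exact ContMDiffAt.comp p (hφsymm _ (hp2 1 (by norm_num)).1) (h1.comp p (hqat p hpu))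
    · change φ.symm (Z (q p) 0) = _
      rw [hp0]
      exact φ.left_inv hpu
    · intro t ht
      obtain ⟨hU, hd⟩ := hp2 t ht
      have h1 := HasMFDerivAt.comp t (hsymmD _ hU) hd.hasFDerivAt.hasMFDerivAt
      have h2 : (mfderiv 𝓘(ℝ, EG) IG φ.symm (Z (q p) t) : EG →L[ℝ] EG).comp
          (ContinuousLinearMap.toSpanSingleton ℝ (W (Z (q p) t) (q p).2)) =
          (1 : ℝ →L[ℝ] ℝ).smulRight (D.actDeriv (φ.symm (Z (q p) t)) p.2 : EG) := by
        ext
        have := hL _ hU p.2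
        simp only [ContinuousLinearMap.comp_apply, ContinuousLinearMap.smulRight_apply, one_smul,
          one_apply_eq_self]
        rw [← this]
        exact congrArg (mfderiv 𝓘(ℝ, EG) IG φ.symm (Z (q p) t)) (one_smul ℝ _)
      refine HasMFDerivAt.hasMFDerivWithinAt ?_
      rw [← h2]
      exact h1

end LocalFlow

end LieGroupoid.FibreFamily

/-! ### Exponentials of small sections -/

namespace LieGroupoid.FibreFamily

section Exponential

variable {EG : Type u} [NormedAddCommGroup EG] [NormedSpace ℝ EG]
  {HG : Type*} [TopologicalSpace HG] {IG : ModelWithCorners ℝ EG HG}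
  {EM : Type*} [NormedAddCommGroup EM] [NormedSpace ℝ EM]
  {HM : Type*} [TopologicalSpace HM] {IM : ModelWithCorners ℝ EM HM}
  {𝒢 : Type*} [TopologicalSpace 𝒢] [ChartedSpace HG 𝒢] [IsManifold IG ∞ 𝒢]
  {M : Type*} [TopologicalSpace M] [ChartedSpace HM M] [IsManifold IM ∞ M]
  {F : Type u} [NormedAddCommGroup F] [NormedSpace ℝ F]
  {G : LieGroupoid IG IM 𝒢 M} (D : FibreFamily F G)

/-- The parameter `a` is small enough for the integral curves of `g ↦ D.actDeriv g a` through the units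
to exist on `(-2, 2)`, with value at time `1` depending smoothly on the base point. Both conditions
are local on `M`: the smooth map `S` may depend on the point `y`. The interval only has to contain
`1` in its interior. -/
def IsExpParam (a : F) : Prop :=
  ∀ y : M, ∃ S : M → 𝒢, ContMDiffAt IM IG ∞ S y ∧ ∀ᶠ x in 𝓝 y, ∃ γ : ℝ → 𝒢,
    γ 0 = G.unit x ∧ IsMIntegralCurveOn (I := IG) γ (fun g => D.actDeriv g a) (Ioo (-2) 2) ∧
    γ 1 = S x

/-- Small parameters satisfy `IsExpParam`. The local existence result is uniform over the compact
support of the family, and the integral curves are constant outside of it. -/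
theorem eventually_isExpParam [FiniteDimensional ℝ EG] [IG.Boundaryless] [CompleteSpace F] :
    ∀ᶠ a in 𝓝 (0 : F), D.IsExpParam a := by
  have hcpt : ∀ᶠ a in 𝓝 (0 : F), ∀ y ∈ D.supp, ∃ S : M → 𝒢, ContMDiffAt IM IG ∞ S y ∧
      ∀ᶠ x in 𝓝 y, ∃ γ : ℝ → 𝒢, γ 0 = G.unit x ∧
        IsMIntegralCurveOn (I := IG) γ (fun g => D.actDeriv g a) (Ioo (-2) 2) ∧ γ 1 = S x := by
    refine D.isCompact_supp.eventually_forall_of_forall_eventually fun y _ => ?_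
    obtain ⟨S, -, -, hS⟩ := D.exists_contMDiffAt_flow y
    have hS' := (continuous_swap.tendsto ((0 : F), y)).eventually hS.eventually_nhds
    filter_upwards [hS'] with p hp
    obtain ⟨a, x⟩ := p
    have hp' : ∀ᶠ q in 𝓝 (x, a), _ := hp
    have hc : Continuous fun x' : M => (x', a) := by fun_prop
    refine ⟨fun x' => S (x', a), ?_, ?_⟩
    · exact hp'.self_of_nhds.1.comp x (contMDiffAt_id.prodMk contMDiffAt_const)
    · filter_upwards [hc.continuousAt.eventually hp'] with x' hx'
      exact hx'.2
  filter_upwards [hcpt] with a ha y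
  by_cases hy : y ∈ D.supp
  · exact ha y hy
  · refine ⟨G.unit, G.contMDiff_unit.contMDiffAt, ?_⟩
    filter_upwards [D.isClosed_supp.isOpen_compl.mem_nhds hy] with x hx
    refine ⟨fun _ => G.unit x, rfl, (isMIntegralCurve_const ?_).isMIntegralCurveOn _, rfl⟩
    rw [D.actDeriv_of_notMem (by rwa [G.tgt_unit])]
    rfl

/-- Integral curves stay in a source fibre. -/
theorem src_integralCurve [IM.Boundaryless] [T2Space M] {a : F} {γ : ℝ → 𝒢} {r : ℝ} (hr : 0 < r)
    (hγ : IsMIntegralCurveOn (I := IG) γ (fun g => D.actDeriv g a) (Ioo (-r) r)) :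
    ∀ t ∈ Ioo (-r) r, G.src (γ t) = G.src (γ 0) := by
  have hz : ContMDiff IM IM.tangent 1
      (fun x => (⟨x, (0 : TangentSpace IM x)⟩ : TangentBundle IM M)) :=
    Bundle.contMDiff_zeroSection ℝ (TangentSpace IM : M → Type _)
  have h1 : IsMIntegralCurveOn (I := IM) (fun t => G.src (γ t)) (fun _ => 0) (Ioo (-r) r) :=
    fun t ht => by
      have h2 := HasMFDerivAt.comp_hasMFDerivWithinAt (g := G.src) t
        (G.isSubmersion_src.contMDiff.mdifferentiable (by simp) (γ t)).hasMFDerivAt (hγ t ht)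
      have h3 : (mfderiv IG IM G.src (γ t) : EG →L[ℝ] EM).comp
          ((1 : ℝ →L[ℝ] ℝ).smulRight (D.actDeriv (γ t) a : EG)) =
          (1 : ℝ →L[ℝ] ℝ).smulRight (0 : EM) := by
        ext
        simp only [ContinuousLinearMap.comp_apply, ContinuousLinearMap.smulRight_apply,
          one_apply_eq_self, one_smul]
        exact (D.mfderiv_src_actDeriv (γ t) a).trans (one_smul ℝ (0 : EM)).symm
      exact h2.congr_mfderiv h3
  have h0 : IsMIntegralCurveOn (I := IM) (fun _ => G.src (γ 0)) (fun _ => 0) (Ioo (-r) r) :=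
    (isMIntegralCurve_const rfl).isMIntegralCurveOn _
  exact isMIntegralCurveOn_Ioo_eqOn_of_contMDiff_boundaryless (t₀ := 0) (by simp [hr]) hz h1 h0 rfl

/-- Left translates of integral curves are integral curves. -/
theorem isMIntegralCurveOn_mul_left [IM.Boundaryless] [T2Space M] {a : F} {γ : ℝ → 𝒢} {r : ℝ}
    (hr : 0 < r) (hγ : IsMIntegralCurveOn (I := IG) γ (fun g => D.actDeriv g a) (Ioo (-r) r))
    {g : 𝒢} (hg : G.tgt g = G.src (γ 0)) :
    IsMIntegralCurveOn (I := IG) (fun t => G.mul g (γ t)) (fun g => D.actDeriv g a)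
      (Ioo (-r) r) := fun t ht => by
  have hsrc : ∀ t ∈ Ioo (-r) r, G.src (γ t) = G.tgt g := fun t ht => by
    rw [D.src_integralCurve hr hγ t ht, hg]
  have hL := ((G.contMDiffOn_mul_left g).mdifferentiableOn (by simp) (γ t)
    (hsrc t ht)).hasMFDerivWithinAt
  have h1 := HasMFDerivWithinAt.comp t hL (hγ t ht) hsrc
  have h2 := D.apply_actDeriv (hsrc t ht).symm hL a
  have h3 : (mfderivWithin IG IG (G.mul g) (G.src ⁻¹' {G.tgt g}) (γ t) : EG →L[ℝ] EG).comp
      ((1 : ℝ →L[ℝ] ℝ).smulRight (D.actDeriv (γ t) a : EG)) =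
      (1 : ℝ →L[ℝ] ℝ).smulRight (D.actDeriv (G.mul g (γ t)) a : EG) := by
    ext
    simp only [ContinuousLinearMap.comp_apply, ContinuousLinearMap.smulRight_apply,
      one_apply_eq_self, one_smul]
    exact h2
  exact h1.congr_mfderiv h3

theorem isMIntegralCurve_mul_left [IM.Boundaryless] [T2Space M] {a : F} {γ : ℝ → 𝒢}
    (hγ : IsMIntegralCurve (I := IG) γ (fun g => D.actDeriv g a))
    {g : 𝒢} (hg : G.tgt g = G.src (γ 0)) :
    IsMIntegralCurve (I := IG) (fun t => G.mul g (γ t)) (fun g => D.actDeriv g a) := fun t => by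
  have ht : t ∈ Ioo (-(|t| + 1)) (|t| + 1) := abs_lt.1 (lt_add_one _)
  have h := D.isMIntegralCurveOn_mul_left (r := |t| + 1) (by positivity) (hγ.isMIntegralCurveOn _) hg
  exact (h.isMIntegralCurveAt (isOpen_Ioo.mem_nhds ht)).hasMFDerivAt

variable [IG.Boundaryless] [IM.Boundaryless] [T2Space 𝒢] [T2Space M]

omit [IM.Boundaryless] [T2Space M] in
theorem integralCurve_one_eq {a : F} {γ γ' : ℝ → 𝒢}
    (hγ : IsMIntegralCurveOn (I := IG) γ (fun g => D.actDeriv g a) (Ioo (-2) 2))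
    (hγ' : IsMIntegralCurveOn (I := IG) γ' (fun g => D.actDeriv g a) (Ioo (-2) 2))
    (h : γ 0 = γ' 0) : γ 1 = γ' 1 :=
  isMIntegralCurveOn_Ioo_eqOn_of_contMDiff_boundaryless (t₀ := 0) (by norm_num)
    ((D.contMDiff_actDeriv a).of_le (by simp)) hγ hγ' h (by norm_num)

/-- Running the flow backwards from its time-`1` value leads back to the unit. -/
theorem mul_integralCurve_neg {a : F} {γ γ' : ℝ → 𝒢} {x : M}
    (hγ : IsMIntegralCurve (I := IG) γ (fun g => D.actDeriv g a)) (h0 : γ 0 = G.unit x)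
    (hγ' : IsMIntegralCurve (I := IG) γ' (fun g => D.actDeriv g (-a)))
    (h0' : γ' 0 = G.unit (G.tgt (γ 1))) : G.mul (γ 1) (γ' 1) = G.unit x := by
  have h1 : IsMIntegralCurve (I := IG) ((γ ∘ (· + 1)) ∘ (· * (-1)))
      (fun g => D.actDeriv g (-a)) := by
    have h2 := (hγ.comp_add 1).comp_mul (-1)
    have h3 : ((-1 : ℝ) • fun g => D.actDeriv g a) = fun g => D.actDeriv g (-a) := by
      funext g
      simp
    rwa [h3] at h2
  have h2 := D.isMIntegralCurve_mul_left hγ' (g := γ 1) (by rw [h0', G.src_unit])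
  have h3 := D.integralCurve_one_eq (h2.isMIntegralCurveOn _) (h1.isMIntegralCurveOn _)
    (by simp [h0', G.mul_unit])
  simpa [h0] using h3

variable [FiniteDimensional ℝ EG]

/-- The fields are complete: left translates of the integral curves through the units are integral
curves, so that all of them exist for the same time. -/
theorem IsExpParam.exists_integralCurve {a : F} (ha : D.IsExpParam a) (g : 𝒢) :
    ∃ γ : ℝ → 𝒢, γ 0 = g ∧ IsMIntegralCurve (I := IG) γ (fun g => D.actDeriv g a) := by
  have : CompleteSpace EG := FiniteDimensional.complete ℝ EG
  refine exists_isMIntegralCurve_of_isMIntegralCurveOn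
    ((D.contMDiff_actDeriv a).of_le (by simp)) (ε := 2) (by norm_num) (fun g => ?_) g
  obtain ⟨S, -, hS⟩ := ha (G.tgt g)
  obtain ⟨γ, h0, hγ, -⟩ := hS.self_of_nhds
  refine ⟨fun t => G.mul g (γ t), by simp only [h0, G.mul_unit], ?_⟩
  exact D.isMIntegralCurveOn_mul_left (by norm_num) hγ (by rw [h0, G.src_unit])

/-- The exponential map at time `1`. Its smoothness at a point comes from the local solutions, which
agree with it by uniqueness of integral curves. -/
theorem IsExpParam.exists_exp {a : F} (ha : D.IsExpParam a) :
    ∃ s : M → 𝒢, ContMDiff IM IG ∞ s ∧ (∀ x, G.src (s x) = x) ∧ ∀ x, ∃ γ : ℝ → 𝒢,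
      IsMIntegralCurve (I := IG) γ (fun g => D.actDeriv g a) ∧ γ 0 = G.unit x ∧ γ 1 = s x := by
  choose γ h0 hγ using fun x => IsExpParam.exists_integralCurve D ha (G.unit x)
  refine ⟨fun x => γ x 1, fun y => ?_, fun x => ?_, fun x => ⟨γ x, hγ x, h0 x, rfl⟩⟩
  · obtain ⟨S, hSy, hS⟩ := ha y
    refine hSy.congr_of_eventuallyEq ?_
    filter_upwards [hS] with x hx
    obtain ⟨γ', h0', hγ', h1'⟩ := hx
    rw [← h1']
    exact D.integralCurve_one_eq ((hγ x).isMIntegralCurveOn _) hγ' (by rw [h0, h0'])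
  · rw [D.src_integralCurve (r := 2) (by norm_num) ((hγ x).isMIntegralCurveOn _) 1 (by norm_num),
      h0, G.src_unit]

/-- The exponentials for `a` and `-a` are bisections, inverse to each other. Inverting the first one
is also what makes `β ∘ exp` a diffeomorphism. -/
theorem exists_exp_bisection {a : F} (ha : D.IsExpParam a) (ha' : D.IsExpParam (-a)) :
    ∃ e e' : Bisection G, (D.algebroidSection a).IsExp e ∧ (D.algebroidSection (-a)).IsExp e' ∧
      e * e' = 1 := by
  obtain ⟨s, hs, hsrc, hsγ⟩ := IsExpParam.exists_exp D ha
  obtain ⟨s', hs', hsrc', hsγ'⟩ := IsExpParam.exists_exp D ha'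
  have hinv : ∀ x, G.mul (s x) (s' (G.tgt (s x))) = G.unit x := fun x => by
    obtain ⟨γ, hγ, h0, h1⟩ := hsγ x
    obtain ⟨γ', hγ', h0', h1'⟩ := hsγ' (G.tgt (s x))
    rw [← h1', ← h1]
    exact D.mul_integralCurve_neg hγ h0 hγ' (by rw [h0', h1])
  have hinv' : ∀ x, G.mul (s' x) (s (G.tgt (s' x))) = G.unit x := fun x => by
    obtain ⟨γ, hγ, h0, h1⟩ := hsγ' x
    obtain ⟨γ', hγ', h0', h1'⟩ := hsγ (G.tgt (s' x))
    rw [← h1', ← h1]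
    exact D.mul_integralCurve_neg hγ h0 (by simpa using hγ') (by rw [h0', h1])
  have htgt : ∀ x, G.tgt (s' (G.tgt (s x))) = x := fun x => by
    rw [← G.tgt_mul _ _ (hsrc' _).symm, hinv, G.tgt_unit]
  have htgt' : ∀ x, G.tgt (s (G.tgt (s' x))) = x := fun x => by
    rw [← G.tgt_mul _ _ (hsrc _).symm, hinv', G.tgt_unit]
  let φ : M ≃ₘ^∞⟮IM, IM⟯ M :=
    { toFun := fun x => G.tgt (s x)
      invFun := fun x => G.tgt (s' x)
      left_inv := htgt
      right_inv := htgt'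
      contMDiff_toFun := G.isSubmersion_tgt.contMDiff.comp hs
      contMDiff_invFun := G.isSubmersion_tgt.contMDiff.comp hs' }
  have hfield : ∀ b : F, (D.algebroidSection b).leftInvariantField = fun g => D.actDeriv g b :=
    fun b => funext fun g => D.leftInvariantField_algebroidSection b g
  refine ⟨⟨s, hs, hsrc, φ, fun _ => rfl⟩, ⟨s', hs', hsrc', φ.symm, fun _ => rfl⟩, fun x => ?_,
    fun x => ?_, Bisection.ext' hinv⟩
  · rw [hfield]; exact hsγ x
  · rw [hfield]; exact hsγ' x

end Exponential

end LieGroupoid.FibreFamily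

/-! ### Arrows on finitely generated bisections -/

namespace LieGroupoid

section Covering

variable {EG : Type u} [NormedAddCommGroup EG] [NormedSpace ℝ EG]
  {HG : Type*} [TopologicalSpace HG] {IG : ModelWithCorners ℝ EG HG}
  {EM : Type*} [NormedAddCommGroup EM] [NormedSpace ℝ EM]
  {HM : Type*} [TopologicalSpace HM] {IM : ModelWithCorners ℝ EM HM}
  {𝒢 : Type*} [TopologicalSpace 𝒢] [ChartedSpace HG 𝒢] [IsManifold IG ∞ 𝒢]
  {M : Type*} [TopologicalSpace M] [ChartedSpace HM M] [IsManifold IM ∞ M]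

theorem Bisection.FinitelyGenerated.mul {G : LieGroupoid IG IM 𝒢 M} {s w : Bisection G}
    (hs : s.FinitelyGenerated) (hw : w.FinitelyGenerated) : (s * w).FinitelyGenerated := by
  obtain ⟨k, X, e, hX, he, rfl⟩ := hs
  obtain ⟨l, Y, f, hY, hf, rfl⟩ := hw
  refine ⟨k + l, Fin.append X Y, Fin.append e f, fun i => ?_, fun i => ?_, ?_⟩
  · refine Fin.addCases (fun i => ?_) (fun i => ?_) i
    · simpa using hX i
    · simpa using hY i
  · refine Fin.addCases (fun i => ?_) (fun i => ?_) i
    · simpa using he i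
    · simpa using hf i
  · rw [List.ofFn_fin_append, List.prod_append]

theorem Bisection.finitelyGenerated_one {G : LieGroupoid IG IM 𝒢 M} :
    (1 : Bisection G).FinitelyGenerated :=
  ⟨0, Fin.elim0, Fin.elim0, fun i => i.elim0, fun i => i.elim0, by simp⟩

theorem AlgebroidSection.IsExp.finitelyGenerated {G : LieGroupoid IG IM 𝒢 M}
    {X : AlgebroidSection G} {e : Bisection G} (he : X.IsExp e) (hX : X.HasCompactSupport) :
    e.FinitelyGenerated :=
  ⟨1, fun _ => X, fun _ => e, fun _ => hX, fun _ => he, by simp⟩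

variable [FiniteDimensional ℝ EG] [IG.Boundaryless] [FiniteDimensional ℝ EM] [IM.Boundaryless]
  [T2Space 𝒢] [T2Space M]

/-- Exponentials of compactly supported sections fill a neighbourhood of the unit at `x₀` in its
source fibre. Each comes with the exponential of the opposite section as its inverse. -/
theorem eventually_exists_exp_apply_eq (G : LieGroupoid IG IM 𝒢 M) (x₀ : M) :
    ∀ᶠ k in 𝓝[G.src ⁻¹' {x₀}] (G.unit x₀), ∃ e e' : Bisection G,
      e.FinitelyGenerated ∧ e'.FinitelyGenerated ∧ e * e' = 1 ∧ e x₀ = k := by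
  obtain ⟨F, _, _, _, D, ρ, hρ, hρD, N, hN, hinj⟩ := G.exists_fibreFamily x₀
  have : CompleteSpace F := FiniteDimensional.complete ℝ F
  obtain ⟨S, hS0, hSd, hS⟩ := D.exists_contMDiffAt_flow x₀
  have hι : Continuous fun a : F => (x₀, a) := by fun_prop
  have hS' := (hι.tendsto 0).eventually hS
  have hSat : ContMDiffAt 𝓘(ℝ, F) IG ∞ (fun a => S (x₀, a)) 0 :=
    hS.self_of_nhds.1.comp (0 : F) (contMDiffAt_const.prodMk contMDiffAt_id)
  have hρd : ∀ k, k = G.unit x₀ →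
      HasMFDerivAt IG 𝓘(ℝ, F) ρ k (mfderiv IG 𝓘(ℝ, F) ρ (G.unit x₀) : EG →L[ℝ] F) := by
    rintro k rfl
    exact (hρ.mdifferentiableAt (by simp)).hasMFDerivAt
  -- In the coordinate `ρ` on the fibre, `a ↦ S (x₀, a)` has derivative `id` at `0`.
  set H : F → F := fun a => ρ (S (x₀, a)) with hH
  have hHd : HasFDerivAt H (ContinuousLinearMap.id ℝ F) 0 := by
    have h1 := HasMFDerivAt.comp (0 : F) (hρd _ (D.act_zero _)) (D.hasMFDerivAt_act (G.unit x₀))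
    have h2 : HasMFDerivAt 𝓘(ℝ, F) 𝓘(ℝ, F) (ρ ∘ D.act (G.unit x₀)) 0
        (ContinuousLinearMap.id ℝ F) := by
      refine (hasFDerivAt_id (0 : F)).hasMFDerivAt.congr_of_eventuallyEq ?_
      filter_upwards [hρD] with v hv
      simp only [Function.comp_apply, D.act_unit, hv, id]
    have h3 := HasMFDerivAt.comp (0 : F) (hρd _ hS0) hSd
    have h4 := hasMFDerivAt_unique h1 h2
    exact (h3.congr_mfderiv h4).hasFDerivAt
  have hHc : ContDiffAt ℝ ∞ H 0 := by
    have h1 : ContMDiffAt IG 𝓘(ℝ, F) ∞ ρ (S (x₀, 0)) := by rw [hS0]; exact hρ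
    exact (ContMDiffAt.comp (0 : F) h1 hSat).contDiffAt
  have hmap : Filter.map H (𝓝 0) = 𝓝 (H 0) :=
    (hHc.hasStrictFDerivAt' (f' := (ContinuousLinearEquiv.refl ℝ F : F →L[ℝ] F)) hHd
      (by simp)).map_nhds_eq_of_equiv
  have hneg : ∀ᶠ a in 𝓝 (0 : F), D.IsExpParam (-a) := by
    have h : Filter.Tendsto (fun a : F => -a) (𝓝 0) (𝓝 0) := by
      simpa using (continuous_neg (G := F)).tendsto 0
    exact h.eventually D.eventually_isExpParam
  have hSN : ∀ᶠ a in 𝓝 (0 : F), S (x₀, a) ∈ N :=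
    hSat.continuousAt.eventually (show N ∈ 𝓝 (S (x₀, 0)) by rw [hS0]; exact hN)
  have himage := Filter.image_mem_map (m := H)
    ((D.eventually_isExpParam.and hneg).and (hS'.and hSN))
  rw [hmap, hH] at himage
  simp only [hS0] at himage
  filter_upwards [mem_nhdsWithin_of_mem_nhds (hρ.continuousAt.eventually himage),
    mem_nhdsWithin_of_mem_nhds hN, self_mem_nhdsWithin] with k hk hkN hksrc
  obtain ⟨a, ⟨⟨ha, ha'⟩, ⟨-, γ, h0, hγ, h1⟩, haN⟩, hak⟩ := hk
  obtain ⟨e, e', he, he', hee'⟩ := D.exists_exp_bisection ha ha'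
  refine ⟨e, e', he.finitelyGenerated (D.hasCompactSupport_algebroidSection a),
    he'.finitelyGenerated (D.hasCompactSupport_algebroidSection (-a)), hee', ?_⟩
  have hfield : (D.algebroidSection a).leftInvariantField = fun g => D.actDeriv g a :=
    funext fun g => D.leftInvariantField_algebroidSection a g
  obtain ⟨γ', hγ', h0', h1'⟩ := he x₀
  rw [hfield] at hγ'
  have heS : e x₀ = S (x₀, a) := by
    rw [← h1', ← h1]
    exact D.integralCurve_one_eq (hγ'.isMIntegralCurveOn _) hγ (by rw [h0', h0])
  rw [heS]
  refine hinj _ haN _ hkN ?_ hak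
  rw [← heS, e.src_apply']
  exact hksrc.symm

/-- Lying on a finitely generated bisection is a locally constant property on a source fibre: a
point `k` near `h` is `h` times an exponential `e` at `β(h)`, so bisections through `h` are multiplied
on the right by `e`, and bisections through `k` by `e⁻¹`. -/
theorem eventually_exists_finitelyGenerated_iff (G : LieGroupoid IG IM 𝒢 M) (x : M) (h : 𝒢)
    (hh : G.src h = x) :
    ∀ᶠ k in 𝓝[G.src ⁻¹' {x}] h,
      ((∃ s : Bisection G, s.FinitelyGenerated ∧ s x = h) ↔
        ∃ s : Bisection G, s.FinitelyGenerated ∧ s x = k) := by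
  subst hh
  have hmaps : MapsTo (G.mul (G.inv h)) (G.src ⁻¹' {G.src h}) (G.src ⁻¹' {G.tgt h}) :=
    fun k hk => by
      have hk' : G.tgt (G.inv h) = G.src k := by rw [G.tgt_inv]; exact (Eq.symm hk)
      simp [G.src_mul _ _ hk', G.src_inv]
  have hcont : ContinuousWithinAt (G.mul (G.inv h)) (G.src ⁻¹' {G.src h}) h := by
    have := (G.contMDiffOn_mul_left (G.inv h)).continuousOn h (by simp [G.tgt_inv])
    rwa [G.tgt_inv] at this
  have ht : Filter.Tendsto (G.mul (G.inv h)) (𝓝[G.src ⁻¹' {G.src h}] h)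
      (𝓝[G.src ⁻¹' {G.tgt h}] (G.unit (G.tgt h))) := by
    rw [← G.inv_mul h]
    exact tendsto_nhdsWithin_iff.2 ⟨hcont, eventually_nhdsWithin_of_forall hmaps⟩
  filter_upwards [ht.eventually (G.eventually_exists_exp_apply_eq (G.tgt h)),
    self_mem_nhdsWithin] with k hk hksrc
  obtain ⟨e, e', he, he', hee', hek⟩ := hk
  have hks : G.src k = G.src h := hksrc
  have hmul : G.mul h (e (G.tgt h)) = k := by
    rw [hek, G.mul_assoc _ _ _ (G.src_inv h).symm (by rw [G.tgt_inv, hks]), G.mul_inv, ← hks,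
      G.unit_mul]
  constructor
  · rintro ⟨s, hs, hsh⟩
    exact ⟨s * e, hs.mul he, by rw [Bisection.mul_apply, hsh, hmul]⟩
  · rintro ⟨s, hs, hsk⟩
    refine ⟨s * e', hs.mul he', ?_⟩
    have h1 : G.tgt k = G.tgt (e (G.tgt h)) := by
      rw [← hmul, G.tgt_mul _ _ (e.src_apply' _).symm]
    have h2 : G.mul (e (G.tgt h)) (e' (G.tgt (e (G.tgt h)))) = G.unit (G.tgt h) :=
      congrArg (fun b : Bisection G => b (G.tgt h)) hee'
    rw [Bisection.mul_apply, hsk, h1, ← hmul, ← G.mul_assoc _ _ _ (e.src_apply' _).symm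
      (e'.src_apply' _).symm, h2, G.mul_unit]

end Covering

end LieGroupoid

end

theorem theorem3p1
    {EG : Type*} [NormedAddCommGroup EG] [NormedSpace ℝ EG] [FiniteDimensional ℝ EG]
    {HG : Type*} [TopologicalSpace HG] (IG : ModelWithCorners ℝ EG HG) [IG.Boundaryless]
    {EM : Type*} [NormedAddCommGroup EM] [NormedSpace ℝ EM] [FiniteDimensional ℝ EM]
    {HM : Type*} [TopologicalSpace HM] (IM : ModelWithCorners ℝ EM HM) [IM.Boundaryless]
    {𝒢 : Type*} [TopologicalSpace 𝒢] [T2Space 𝒢] [ChartedSpace HG 𝒢] [IsManifold IG ∞ 𝒢]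
    {M : Type*} [TopologicalSpace M] [T2Space M] [ChartedSpace HM M] [IsManifold IM ∞ M]
    (G : LieGroupoid IG IM 𝒢 M) (hG : G.SourceConnected) (g : 𝒢) :
    ∃ s : G.Bisection, s (G.src g) = g ∧ s.FinitelyGenerated := by
  set x := G.src g
  have key := (hG x).isPreconnected.induction₂
    (fun h k => (∃ s : G.Bisection, s.FinitelyGenerated ∧ s x = h) ↔
      ∃ s : G.Bisection, s.FinitelyGenerated ∧ s x = k)
    (fun h hh => G.eventually_exists_finitelyGenerated_iff x h hh)
    (fun _ _ _ _ _ _ h₁ h₂ => h₁.trans h₂) (fun _ _ _ _ h => h.symm)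
    (x := G.unit x) (y := g) (G.src_unit x) rfl
  obtain ⟨s, hs, hsg⟩ := key.1 ⟨1, LieGroupoid.Bisection.finitelyGenerated_one, rfl⟩
  exact ⟨s, hsg, hs⟩
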